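/- Let $n\ge 1$, let $G$ be a Lie group with Lie algebra $\mathfrak g$, let $\pi:P\to\mathbb S^{2n}$ be a smooth principal $G$-bundle over the unit sphere of $\mathbb R^{2n+1}$, and let $\omega\in\Omega^1(P;\mathfrak g)$ be a principal connection. Let $f:\mathbb R^{2n+1}\setminus\{0\}\to\mathbb S^{2n}$, $f(x)=x/\|x\|$, let $\bar\pi:f^*P\to\mathbb R^{2n+1}\setminus\{0\}$, $f^*P=\{(p,x)\mid \pi(p)=f(x)\}$, $\bar\pi(p,x)=x$, be the pullback bundle, $F:f^*P\to P$, $F(p,x)=p$, the canonical bundle homomorphism, and $r(x)=\|x\|$. For a connection $\omega$ on a principal bundle over an oriented Riemannian manifold of dimension $m$, $D^\omega\varphi$ denotes the horizontal part of $d\varphi$, $\Omega^\omega=D^\omega\omega$ the curvature, $*$ the Hodge star acting on horizontal $G$-equivariant $\mathfrak g$-valued forms on the bundle through their identification with $\mathrm{Ad}(P)$-valued forms on the base (normalized by $\theta\wedge *\varphi=\langle\theta,\varphi\rangle\mu$, $\mu$ the volume form), and $\delta^{\omega}\varphi=-(-1)^{m(k+1)}*D^\omega*\varphi$ for $\varphi$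 of degree $k$ the covariant codifferential. The connection $\omega$ is called Yang–Mills if $\delta^\omega\Omega^\omega=0$. The sphere carries the round metric and the orientation as boundary of the ball, $\mathbb R^{2n+1}\setminus\{0\}$ the Euclidean metric and the standard orientation. Then $F^*\omega$ is a principal connection on $f^*P$, $$*D^{F^*\omega}*\,\Omega^{F^*\omega}=-\frac{1}{\bar\pi^*(r^2)}\,F^*\bigl(*D^{\omega}*\,\Omega^{\omega}\bigr),$$ and equivalently, in terms of the codifferential (with $m=2n+1$ on the left and $m=2n$ on the right), $$\delta^{F^*\omega}\,\Omega^{F^*\omega}=\frac{1}{\bar\pi^*(r^2)}\,F^*\bigl(\delta^{\omega}\,\Omega^{\omega}\bigr).$$ In particular, $\omega$ is a Yang–Mills connection if and only if $F^*\omega$ is a Yang–Mills connection. -/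

import Mathlib

open Set Metric
open scoped Manifold ContDiff Topology RealInnerProductSpace

noncomputable section

/-! ### Differential forms on manifolds -/

/-- `V`-valued differential `k`-forms on `M` (not necessarily smooth, see `DForm.IsSmooth`). -/
abbrev DForm {E H : Type*} [NormedAddCommGroup E] [NormedSpace ℝ E] [TopologicalSpace H]
    (I : ModelWithCorners ℝ E H) (M : Type*) [TopologicalSpace M] [ChartedSpace H M] (k : ℕ)
    (V : Type*) [NormedAddCommGroup V] [NormedSpace ℝ V] :=
  ∀ x : M, TangentSpace I x [⋀^Fin k]→L[ℝ] V

namespace DForm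

variable {E H E' H' V : Type*} [NormedAddCommGroup E] [NormedSpace ℝ E] [TopologicalSpace H]
  {I : ModelWithCorners ℝ E H} {M : Type*} [TopologicalSpace M] [ChartedSpace H M]
  [NormedAddCommGroup E'] [NormedSpace ℝ E'] [TopologicalSpace H']
  {I' : ModelWithCorners ℝ E' H'} {M' : Type*} [TopologicalSpace M'] [ChartedSpace H' M']
  [NormedAddCommGroup V] [NormedSpace ℝ V] {k : ℕ}

/-- The pullback `F^* φ` of a differential form under a map `F`. -/
def pullback (I' : ModelWithCorners ℝ E' H') (F : M' → M) (φ : DForm I M k V) :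
    DForm I' M' k V :=
  fun x => (φ (F x)).compContinuousLinearMap (mfderiv I' I F x)

/-- The expression of a form in the preferred chart at `x₀`: its pullback under the inverse of
the chart, a form on (the target of the chart in) the model vector space. -/
def inChart (φ : DForm I M k V) (x₀ : M) : E → E [⋀^Fin k]→L[ℝ] V :=
  fun y => (φ ((extChartAt I x₀).symm y)).compContinuousLinearMap
    ((mfderiv 𝓘(ℝ, E) I (extChartAt I x₀).symm y).comp
      (NormedSpace.fromTangentSpace (𝕜 := ℝ) y).symm.toContinuousLinearMap)

/-- Smoothness (`C^∞`) of a form on a manifold without boundary. -/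
def IsSmooth (φ : DForm I M k V) : Prop :=
  ∀ x₀ : M, ContDiffOn ℝ ∞ (inChart φ x₀) (extChartAt I x₀).target

/-- The exterior derivative on a manifold without boundary, computed at `x` in the chart at `x`. -/
def extd (φ : DForm I M k V) : DForm I M (k + 1) V :=
  fun x => (extDeriv (inChart φ x) (extChartAt I x x)).compContinuousLinearMap
    (mvfderiv I (extChartAt I x) x)

end DForm

/-! ### The Hodge star on an oriented inner product space -/

section Hodge

theorem append_update_cast {T : Type*} {k l m : ℕ} (h : k + l = m) (u : Fin k → T) (v : Fin l → T) (i : Fin l) (x : T) :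
    (fun j : Fin m => Fin.append u (Function.update v i x) (Fin.cast h.symm j)) =
      Function.update (fun j : Fin m => Fin.append u v (Fin.cast h.symm j))
        (Fin.cast h (Fin.natAdd k i)) x := by
  subst h
  funext j
  refine Fin.addCases (fun a => ?_) (fun a => ?_) j
  · have : Fin.castAdd l a ≠ Fin.natAdd k i := by
      intro hh; have := congrArg Fin.val hh; simp at this; omega
    simp [Function.update, this]
  · by_cases hai : a = i
    · subst hai; simp
    · have : Fin.natAdd k a ≠ Fin.natAdd k i := by
        intro hh; exact hai (by simpa using hh)
      simp [Function.update, hai]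

variable {T V : Type*} [AddCommGroup T] [Module ℝ T] [TopologicalSpace T]
  [NormedAddCommGroup V] [NormedSpace ℝ V] {k l m : ℕ}

/-- The form `v ↦ μ (u₁, …, u_k, v₁, …, v_l)`. -/
def contract (h : k + l = m) (μ : T [⋀^Fin m]→L[ℝ] ℝ) (u : Fin k → T) : T [⋀^Fin l]→L[ℝ] ℝ where
  toFun v := μ fun j => Fin.append u v (Fin.cast h.symm j)
  map_update_add' := by
    intro inst v i x y
    obtain rfl : inst = instDecidableEqFin l := Subsingleton.elim _ _
    change μ _ = μ _ + μ _
    rw [append_update_cast h, append_update_cast h, append_update_cast h]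
    exact μ.map_update_add _ _ _ _
  map_update_smul' := by
    intro inst v i c x
    obtain rfl : inst = instDecidableEqFin l := Subsingleton.elim _ _
    change μ _ = c • μ _
    rw [append_update_cast h, append_update_cast h]
    exact μ.map_update_smul _ _ _ _
  cont := by
    refine μ.coe_continuous.comp (continuous_pi fun j => ?_)
    generalize Fin.cast h.symm j = j'
    refine Fin.addCases (fun a => ?_) (fun a => ?_) j'
    · simpa using continuous_const
    · simpa using continuous_apply a
  map_eq_zero_of_eq' v i j hv hij := by
    refine μ.map_eq_zero_of_eq _ (i := Fin.cast h (Fin.natAdd k i))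
      (j := Fin.cast h (Fin.natAdd k j)) (by simpa using hv) ?_
    intro hh
    exact hij (by simpa using hh)

/-- The Hodge star `∗α` of a `V`-valued `k`-form `α` on an `m`-dimensional real vector space with
inner product `g` and volume form `μ`: for an orthonormal basis `e`,
`(∗α)(v) = ∑_{i₁ < … < i_k} μ(e_{i₁}, …, e_{i_k}, v) • α(e_{i₁}, …, e_{i_k})`, which does not
depend on `e`. Equivalently, `θ ∧ ∗α = ⟨θ, α⟩ μ` for all `k`-forms `θ`. -/
def hodgeStar (g : T → T → ℝ) (μ : T [⋀^Fin m]→L[ℝ] ℝ) (h : k + l = m)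
    (α : T [⋀^Fin k]→L[ℝ] V) : T [⋀^Fin l]→L[ℝ] V :=
  let e : Fin m → T := Classical.epsilon fun e => ∀ i j, g (e i) (e j) = if i = j then 1 else 0
  ∑ s : Fin k ↪o Fin m, (contract h μ (e ∘ s)).smulRight (α (e ∘ s))

end Hodge

/-! ### The Lie algebra and principal bundles -/

section LieAlg

variable {EG HG : Type*} [NormedAddCommGroup EG] [NormedSpace ℝ EG] [TopologicalSpace HG]
  (IG : ModelWithCorners ℝ EG HG) (G : Type*) [TopologicalSpace G] [ChartedSpace HG G] [Group G]

/-- The Lie algebra `𝔤 = T_1 G`, a normed space through the preferred chart at `1`. -/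
def LieAlg : Type _ := GroupLieAlgebra IG G

instance : NormedAddCommGroup (LieAlg IG G) := inferInstanceAs (NormedAddCommGroup EG)
instance : NormedSpace ℝ (LieAlg IG G) := inferInstanceAs (NormedSpace ℝ EG)

variable {G}

/-- The adjoint representation: `Ad_g` is the derivative at `1` of `x ↦ g x g⁻¹`. -/
def Ad (g : G) : LieAlg IG G →L[ℝ] LieAlg IG G :=
  show EG →L[ℝ] EG from mfderiv IG IG (fun x : G => g * x * g⁻¹) 1

end LieAlg

/-- A smooth principal bundle `P → M` with structure group `G`: a smooth right action of `G` on
`P` and a projection which, over a neighbourhood `U` of each point of `M`, are identified by a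
diffeomorphism `ψ : U × G → π⁻¹(U)` with `(y, g) · h = (y, g h)` and `(y, g) ↦ y`. -/
structure PrincipalBundle
    {EG HG : Type*} [NormedAddCommGroup EG] [NormedSpace ℝ EG] [TopologicalSpace HG]
    (IG : ModelWithCorners ℝ EG HG) (G : Type*) [TopologicalSpace G] [ChartedSpace HG G] [Group G]
    {EP HP : Type*} [NormedAddCommGroup EP] [NormedSpace ℝ EP] [TopologicalSpace HP]
    (IP : ModelWithCorners ℝ EP HP) (P : Type*) [TopologicalSpace P] [ChartedSpace HP P]
    {EM HM : Type*} [NormedAddCommGroup EM] [NormedSpace ℝ EM] [TopologicalSpace HM]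
    (IM : ModelWithCorners ℝ EM HM) (M : Type*) [TopologicalSpace M] [ChartedSpace HM M] where
  /-- The projection `π`. -/
  proj : P → M
  /-- The right action `(p, g) ↦ R_g(p) = p · g`. -/
  act : P → G → P
  act_one : ∀ p, act p 1 = p
  act_mul : ∀ p g h, act p (g * h) = act (act p g) h
  proj_act : ∀ p g, proj (act p g) = proj p
  contMDiff_proj : ContMDiff IP IM ∞ proj
  contMDiff_act : ContMDiff (IP.prod IG) IP ∞ (fun q : P × G => act q.1 q.2)
  locally_trivial : ∀ x : M, ∃ (U : Set M) (ψ : M × G → P) (γ : P → G), IsOpen U ∧ x ∈ U ∧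
    ContMDiffOn (IM.prod IG) IP ∞ ψ (U ×ˢ univ) ∧ ContMDiffOn IP IG ∞ γ (proj ⁻¹' U) ∧
    (∀ y ∈ U, ∀ g, proj (ψ (y, g)) = y ∧ γ (ψ (y, g)) = g) ∧
    (∀ p, proj p ∈ U → ψ (proj p, γ p) = p) ∧
    ∀ y ∈ U, ∀ g h, act (ψ (y, g)) h = ψ (y, g * h)

namespace PrincipalBundle

variable
  {EG HG : Type*} [NormedAddCommGroup EG] [NormedSpace ℝ EG] [TopologicalSpace HG]
  {IG : ModelWithCorners ℝ EG HG} {G : Type*} [TopologicalSpace G] [ChartedSpace HG G] [Group G]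
  {EP HP : Type*} [NormedAddCommGroup EP] [NormedSpace ℝ EP] [TopologicalSpace HP]
  {IP : ModelWithCorners ℝ EP HP} {P : Type*} [TopologicalSpace P] [ChartedSpace HP P]
  {EM HM : Type*} [NormedAddCommGroup EM] [NormedSpace ℝ EM] [TopologicalSpace HM]
  {IM : ModelWithCorners ℝ EM HM} {M : Type*} [TopologicalSpace M] [ChartedSpace HM M]
  (B : PrincipalBundle IG G IP P IM M)

/-! ### Principal connections and curvature

Connection forms are called `A`, since `ω` is a notation of the scope `ContDiff`. -/

/-- The fundamental vector field `η_P(p) = d/dt|₀ (p · exp(tη))`: the derivative at `1` of the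
orbit map `g ↦ p · g`, applied to `η`. -/
def fundamental (p : P) : LieAlg IG G →L[ℝ] TangentSpace IP p :=
  show EG →L[ℝ] EP from mfderiv IG IP (fun g : G => B.act p g) 1

/-- The value of a `1`-form at `p` as a linear map. -/
def conn (A : DForm IP P 1 (LieAlg IG G)) (p : P) : TangentSpace IP p →L[ℝ] LieAlg IG G :=
  (ContinuousAlternatingMap.ofSubsingleton ℝ (TangentSpace IP p) (LieAlg IG G) (0 : Fin 1)).symm
    (A p)

/-- Principal connections: smooth `𝔤`-valued `1`-forms with `R_g^* A = Ad_{g⁻¹} A` and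
`A(η_P) = η`. -/
structure IsConnection (A : DForm IP P 1 (LieAlg IG G)) : Prop where
  smooth : A.IsSmooth
  equivariant : ∀ g : G, DForm.pullback IP (fun p => B.act p g) A =
    fun p => (Ad IG g⁻¹).compContinuousAlternatingMap (A p)
  fundamental : ∀ (p : P) (η : LieAlg IG G), conn A p (B.fundamental p η) = η

/-- The projection `X ↦ X^H = X - (A(X))_P` of `T_p P` onto `ker A` along the vertical space. -/
def hor (A : DForm IP P 1 (LieAlg IG G)) (p : P) : TangentSpace IP p →L[ℝ] TangentSpace IP p :=
  ContinuousLinearMap.id ℝ _ - (B.fundamental p).comp (conn A p)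

/-- The covariant derivative `D^A φ (X₁, …) = dφ (X₁^H, …)`. -/
def covD {V : Type*} [NormedAddCommGroup V] [NormedSpace ℝ V] {k : ℕ}
    (A : DForm IP P 1 (LieAlg IG G)) (φ : DForm IP P k V) : DForm IP P (k + 1) V :=
  fun p => (φ.extd p).compContinuousLinearMap (B.hor A p)

/-- The curvature `Ω^A = D^A A`. -/
def curvature (A : DForm IP P 1 (LieAlg IG G)) : DForm IP P 2 (LieAlg IG G) :=
  B.covD A A

/-! ### Hodge star, codifferential and Yang–Mills connections -/

/-- The horizontal lift `Γ_p : T_{π(p)} M → T_p P` of a connection, the linear map with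
`T_pπ ∘ Γ_p = id` and image in `ker A`. -/
def lift (A : DForm IP P 1 (LieAlg IG G)) (p : P) :
    TangentSpace IM (B.proj p) →L[ℝ] TangentSpace IP p :=
  Classical.epsilon fun Γ => (mfderiv IP IM B.proj p).comp Γ = ContinuousLinearMap.id ℝ _ ∧
    (conn A p).comp Γ = 0

/-- The Hodge star of horizontal forms on `P`, with respect to the metric `g` and the volume form
`μ` of the `m`-dimensional base: the form `φ_p ∘ Γ_p` on `T_{π(p)} M` (the `Ad(P)`-valued form
associated with `φ`, read in the frame `p`) is starred and pulled back by `T_p π`. -/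
def star {V : Type*} [NormedAddCommGroup V] [NormedSpace ℝ V] {k l m : ℕ}
    (g : ∀ x : M, TangentSpace IM x → TangentSpace IM x → ℝ) (μ : DForm IM M m ℝ)
    (A : DForm IP P 1 (LieAlg IG G)) (h : k + l = m) (φ : DForm IP P k V) : DForm IP P l V :=
  fun p => (hodgeStar (g (B.proj p)) (μ (B.proj p)) h
    ((φ p).compContinuousLinearMap (B.lift A p))).compContinuousLinearMap (mfderiv IP IM B.proj p)

/-- The operator `∗ D^A ∗` from `(k+1)`-forms to `k`-forms, `k + 1 ≤ m`. -/
def starDStar {V : Type*} [NormedAddCommGroup V] [NormedSpace ℝ V] {k m : ℕ}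
    (g : ∀ x : M, TangentSpace IM x → TangentSpace IM x → ℝ) (μ : DForm IM M m ℝ)
    (A : DForm IP P 1 (LieAlg IG G)) (h : k + 1 ≤ m) (φ : DForm IP P (k + 1) V) :
    DForm IP P k V :=
  B.star g μ A (show m - (k + 1) + 1 + k = m by omega)
    (B.covD A (B.star g μ A (show k + 1 + (m - (k + 1)) = m by omega) φ))

/-- The covariant codifferential `δ_A φ = -(-1)^{m(r+1)} ∗ D^A ∗ φ` of forms of degree
`r = k + 1`, where `m` is the dimension of the base. -/
def codiff {V : Type*} [NormedAddCommGroup V] [NormedSpace ℝ V] {k m : ℕ}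
    (g : ∀ x : M, TangentSpace IM x → TangentSpace IM x → ℝ) (μ : DForm IM M m ℝ)
    (A : DForm IP P 1 (LieAlg IG G)) (h : k + 1 ≤ m) (φ : DForm IP P (k + 1) V) :
    DForm IP P k V :=
  fun p => (-(-1 : ℝ) ^ (m * (k + 1 + 1))) • B.starDStar g μ A h φ p

/-- Yang–Mills connections: principal connections with `δ_A Ω^A = 0`. -/
def IsYangMills {m : ℕ} (g : ∀ x : M, TangentSpace IM x → TangentSpace IM x → ℝ)
    (μ : DForm IM M m ℝ) (h : 2 ≤ m) (A : DForm IP P 1 (LieAlg IG G)) : Prop :=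
  B.IsConnection A ∧ B.codiff g μ A h (B.curvature A) = fun _ => 0

end PrincipalBundle

/-! ### The sphere and punctured space -/

/-- The unit sphere `𝕊^d` in `ℝ^{d+1}`. -/
abbrev Sph (d : ℕ) : Type := sphere (0 : EuclideanSpace ℝ (Fin (d + 1))) 1

/-- Punctured space `ℝ^d \ {0}`, as an open submanifold of `ℝ^d`. -/
abbrev Punctured (d : ℕ) : TopologicalSpace.Opens (EuclideanSpace ℝ (Fin d)) :=
  ⟨{0}ᶜ, isOpen_compl_singleton⟩

theorem two_le_dim_sph {n : ℕ} (hn : 1 ≤ n) : 2 ≤ 2 * n := by omega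

theorem two_le_dim_punc {n : ℕ} (hn : 1 ≤ n) : 2 ≤ 2 * n + 1 := by omega

/-- The standard volume form `dx¹ ∧ … ∧ dx^d` of `ℝ^d`. -/
def euclideanVol (d : ℕ) :
    EuclideanSpace ℝ (Fin d) [⋀^Fin d]→L[ℝ] ℝ where
  __ := (EuclideanSpace.basisFun (Fin d) ℝ).toBasis.det
  cont := by
    change Continuous fun v => (EuclideanSpace.basisFun (Fin d) ℝ).toBasis.det v
    simp only [Module.Basis.det_apply]
    refine Continuous.matrix_det (continuous_matrix fun i j => ?_)
    simp only [Module.Basis.toMatrix_apply, OrthonormalBasis.coe_toBasis_repr_apply,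
      EuclideanSpace.basisFun_repr]
    fun_prop

/-- The round metric of the sphere, induced by the inner product of `ℝ^{d+1}`. -/
def sphMetric (d : ℕ) (x : Sph d) (u v : TangentSpace (𝓡 d) x) : ℝ :=
  ⟪mvfderiv (𝓡 d) (Subtype.val : Sph d → EuclideanSpace ℝ (Fin (d + 1))) x u,
    mvfderiv (𝓡 d) (Subtype.val : Sph d → EuclideanSpace ℝ (Fin (d + 1))) x v⟫

/-- The volume form of the sphere for its standard orientation as the boundary of the ball:
`(v₁, …, v_d) ↦ det(x, v₁, …, v_d)`. -/
def sphVol (d : ℕ) : DForm (𝓡 d) (Sph d) d ℝ :=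
  fun x => ((euclideanVol (d + 1)).curryLeft x.1).compContinuousLinearMap
    (mvfderiv (𝓡 d) (Subtype.val : Sph d → EuclideanSpace ℝ (Fin (d + 1))) x)

/-- The Euclidean metric of punctured space. -/
def puncMetric (d : ℕ) (x : Punctured d) (u v : TangentSpace (𝓡 d) x) : ℝ :=
  ⟪mvfderiv (𝓡 d) (Subtype.val : Punctured d → EuclideanSpace ℝ (Fin d)) x u,
    mvfderiv (𝓡 d) (Subtype.val : Punctured d → EuclideanSpace ℝ (Fin d)) x v⟫

/-- The Euclidean volume form of punctured space. -/
def puncVol (d : ℕ) : DForm (𝓡 d) (Punctured d) d ℝ :=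
  fun x => (euclideanVol d).compContinuousLinearMap
    (mvfderiv (𝓡 d) (Subtype.val : Punctured d → EuclideanSpace ℝ (Fin d)) x)

theorem punctured_norm_pos {d : ℕ} (x : Punctured d) : 0 < ‖x.1‖ := norm_pos_iff.2 x.2

/-- The radial projection `f(x) = x / ‖x‖`. -/
def radial (d : ℕ) (x : Punctured (d + 1)) : Sph d :=
  ⟨‖x.1‖⁻¹ • x.1, by simp [norm_smul, (punctured_norm_pos x).ne']⟩

theorem contMDiff_radial (d : ℕ) : ContMDiff (𝓡 (d + 1)) (𝓡 d) ∞ (radial d) := by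
  have := Fact.mk (@finrank_euclideanSpace_fin ℝ _ (d + 1))
  refine ContMDiff.codRestrict_sphere (n := d) (f := fun x : Punctured (d + 1) => ‖x.1‖⁻¹ • x.1)
    ?_ fun x => (radial d x).2
  intro x
  have h : ContDiffAt ℝ ∞ (fun y : EuclideanSpace ℝ (Fin (d + 1)) => ‖y‖⁻¹ • y) x.1 :=
    ((contDiffAt_norm ℝ x.2).inv (punctured_norm_pos x).ne').smul contDiffAt_id
  exact h.contMDiffAt.comp x (contMDiff_subtype_val x)

/-- The point `exp(t) y` of the ray through `y`. -/
def expRay (d : ℕ) (y : Sph d) (t : ℝ) : Punctured (d + 1) :=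
  ⟨Real.exp t • y.1, smul_ne_zero (Real.exp_ne_zero t) (by
    intro h0; have := y.2; simp [h0] at this)⟩

theorem norm_expRay (d : ℕ) (y : Sph d) (t : ℝ) : ‖(expRay d y t).1‖ = Real.exp t := by
  simp [expRay, norm_smul]

theorem radial_expRay (d : ℕ) (y : Sph d) (t : ℝ) : radial d (expRay d y t) = y := by
  apply Subtype.ext
  change ‖(expRay d y t).1‖⁻¹ • (Real.exp t • y.1) = y.1
  rw [norm_expRay, smul_smul, inv_mul_cancel₀ (Real.exp_ne_zero t), one_smul]

theorem expRay_radial (d : ℕ) (x : Punctured (d + 1)) :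
    expRay d (radial d x) (Real.log ‖x.1‖) = x := by
  apply Subtype.ext
  change Real.exp (Real.log ‖x.1‖) • (‖x.1‖⁻¹ • x.1) = x.1
  rw [Real.exp_log (punctured_norm_pos x), smul_smul, mul_inv_cancel₀ (punctured_norm_pos x).ne', one_smul]

/-! ### Transport of a manifold structure along a homeomorphism -/

section Transport

variable {X Y H E : Type*} [TopologicalSpace X] [TopologicalSpace Y] [TopologicalSpace H]
  [NormedAddCommGroup E] [NormedSpace ℝ E] [ChartedSpace H Y]

/-- The charted space structure for which a homeomorphism is a diffeomorphism. -/
@[reducible]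
def chartedSpaceOfHomeo (h : X ≃ₜ Y) : ChartedSpace H X where
  atlas := (fun c => h.toOpenPartialHomeomorph.trans c) '' atlas H Y
  chartAt x := h.toOpenPartialHomeomorph.trans (chartAt H (h x))
  mem_chart_source x := by simp
  chart_mem_atlas x := ⟨_, chart_mem_atlas H (h x), rfl⟩

variable (I : ModelWithCorners ℝ E H)

theorem isManifold_ofHomeo [IsManifold I ∞ Y] (h : X ≃ₜ Y) :
    @IsManifold ℝ _ E _ _ H _ I ∞ X _ (chartedSpaceOfHomeo h) := by
  let _ : ChartedSpace H X := chartedSpaceOfHomeo h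
  refine isManifold_of_contDiffOn I ∞ X ?_
  rintro _ _ ⟨c, hc, rfl⟩ ⟨c', hc', rfl⟩
  have key := ((contDiffGroupoid ∞ I).compatible hc hc')
  rw [contDiffGroupoid, mem_groupoid_of_pregroupoid] at key
  refine (key.1).congr_mono (fun y hy => ?_) (fun y hy => ?_)
  · simp
  · simpa using hy

theorem contMDiff_ofHomeo (h : X ≃ₜ Y) :
    letI : ChartedSpace H X := chartedSpaceOfHomeo h
    ContMDiff I I ∞ h ∧ ContMDiff I I ∞ h.symm := by
  let _ : ChartedSpace H X := chartedSpaceOfHomeo h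
  constructor
  · intro x
    refine contMDiffAt_iff.2 ⟨h.continuous.continuousAt, ?_⟩
    refine contDiffWithinAt_id.congr_of_eventuallyEq ?_ ?_
    · filter_upwards [extChartAt_target_mem_nhdsWithin (I := I) (h x)] with y hy
      have hc : chartAt H x = h.toOpenPartialHomeomorph.trans (chartAt H (h x)) := rfl
      have := (extChartAt I (h x)).right_inv hy
      simpa [extChartAt, hc] using this
    · have hc : chartAt H x = h.toOpenPartialHomeomorph.trans (chartAt H (h x)) := rfl
      simp [extChartAt, hc]
  · intro y
    have hc : chartAt H (h.symm y) = h.toOpenPartialHomeomorph.trans (chartAt H y) := by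
      change h.toOpenPartialHomeomorph.trans (chartAt H (h (h.symm y))) = _
      rw [h.apply_symm_apply]
    refine contMDiffAt_iff.2 ⟨h.symm.continuous.continuousAt, ?_⟩
    refine contDiffWithinAt_id.congr_of_eventuallyEq ?_ ?_
    · filter_upwards [extChartAt_target_mem_nhdsWithin (I := I) y] with z hz
      have := (extChartAt I y).right_inv hz
      simpa [extChartAt, hc] using this
    · simp [extChartAt, hc]

end Transport

/-! ### The pullback bundle `f^* P` under the radial projection -/

namespace PrincipalBundle

variable
  {EG HG : Type*} [NormedAddCommGroup EG] [NormedSpace ℝ EG] [TopologicalSpace HG]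
  {IG : ModelWithCorners ℝ EG HG} {G : Type*} [TopologicalSpace G] [ChartedSpace HG G] [Group G]
  {EP HP : Type*} [NormedAddCommGroup EP] [NormedSpace ℝ EP] [TopologicalSpace HP]
  {IP : ModelWithCorners ℝ EP HP} {P : Type*} [TopologicalSpace P] [ChartedSpace HP P]
  {d : ℕ} (B : PrincipalBundle IG G IP P (𝓡 d) (Sph d))

/-- The total space `f^* P = {(p, x) ∈ P × (ℝ^{d+1} \ {0}) | π(p) = f(x)}`. -/
@[ext]
structure Pullback where
  /-- The bundle homomorphism `F : f^* P → P`, `(p, x) ↦ p`. -/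
  toP : P
  /-- The projection `f^* P → ℝ^{d+1} \ {0}`, `(p, x) ↦ x`. -/
  base : Punctured (d + 1)
  proj_eq : B.proj toP = radial d base

/-- The inclusion of `f^* P` into `P × (ℝ^{d+1} \ {0})`. -/
def pullbackIncl (q : B.Pullback) : P × Punctured (d + 1) := (q.toP, q.base)

/-- The subspace topology. -/
instance : TopologicalSpace B.Pullback := TopologicalSpace.induced B.pullbackIncl inferInstance

theorem continuous_pullbackIncl : Continuous B.pullbackIncl := continuous_induced_dom

theorem continuous_expRay : Continuous fun z : Sph d × ℝ => expRay d z.1 z.2 :=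
  Continuous.subtype_mk (by fun_prop) _

/-- The homeomorphism `(p, x) ↦ (p, log ‖x‖)` from `f^* P` to `P × ℝ`. -/
def pullbackHomeo : B.Pullback ≃ₜ P × ℝ where
  toFun q := (q.toP, Real.log ‖q.base.1‖)
  invFun z := ⟨z.1, expRay d (B.proj z.1) z.2, (radial_expRay d _ _).symm⟩
  left_inv q := by
    refine Pullback.ext rfl ?_
    change expRay d (B.proj q.toP) (Real.log ‖q.base.1‖) = q.base
    rw [q.proj_eq, expRay_radial]
  right_inv z := by
    refine Prod.ext rfl ?_
    change Real.log ‖(expRay d (B.proj z.1) z.2).1‖ = z.2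
    rw [norm_expRay, Real.log_exp]
  continuous_toFun := by
    refine (continuous_fst.comp B.continuous_pullbackIncl).prodMk (Continuous.log ?_ fun q =>
      (punctured_norm_pos q.base).ne')
    exact (continuous_subtype_val.comp (continuous_snd.comp B.continuous_pullbackIncl)).norm
  continuous_invFun := by
    refine continuous_induced_rng.2 (continuous_fst.prodMk ?_)
    exact continuous_expRay.comp
      ((B.contMDiff_proj.continuous.comp continuous_fst).prodMk continuous_snd)

/-- The manifold structure of `f^* P`, transported from `P × ℝ`. It is the standard one (as a
submanifold of `P × (ℝ^{d+1} \ {0})`): see `contMDiffOn_pullback_iff`. -/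
instance : ChartedSpace (ModelProd HP ℝ) B.Pullback := chartedSpaceOfHomeo B.pullbackHomeo

instance [IsManifold IP ∞ P] : IsManifold (IP.prod 𝓘(ℝ, ℝ)) ∞ B.Pullback :=
  isManifold_ofHomeo _ B.pullbackHomeo

theorem contMDiff_pullbackHomeo :
    ContMDiff (IP.prod 𝓘(ℝ, ℝ)) (IP.prod 𝓘(ℝ, ℝ)) ∞ B.pullbackHomeo :=
  (contMDiff_ofHomeo _ B.pullbackHomeo).1

theorem contMDiff_pullbackHomeo_symm :
    ContMDiff (IP.prod 𝓘(ℝ, ℝ)) (IP.prod 𝓘(ℝ, ℝ)) ∞ B.pullbackHomeo.symm :=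
  (contMDiff_ofHomeo _ B.pullbackHomeo).2

theorem contMDiff_toP :
    ContMDiff (IP.prod 𝓘(ℝ, ℝ)) IP ∞ (Pullback.toP : B.Pullback → P) :=
  (contMDiff_fst (I := IP) (J := 𝓘(ℝ, ℝ)) (M := P) (N := ℝ)).comp B.contMDiff_pullbackHomeo

theorem contMDiff_base :
    ContMDiff (IP.prod 𝓘(ℝ, ℝ)) (𝓡 (d + 1)) ∞
      (Pullback.base : B.Pullback → Punctured (d + 1)) := by
  rw [← ContMDiff.subtypeVal_comp_iff]
  have := Fact.mk (@finrank_euclideanSpace_fin ℝ _ (d + 1))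
  have h1 : ContMDiff (IP.prod 𝓘(ℝ, ℝ)) (𝓡 (d + 1)) ∞
      fun z : P × ℝ => Real.exp z.2 • (B.proj z.1).1 :=
    (Real.contDiff_exp.contMDiff.comp contMDiff_snd).smul
      (contMDiff_coe_sphere.comp (B.contMDiff_proj.comp contMDiff_fst))
  convert h1.comp B.contMDiff_pullbackHomeo using 1
  funext q
  have := congrArg (fun q : B.Pullback => q.base.1) (B.pullbackHomeo.symm_apply_apply q)
  exact this.symm

/-- The smooth structure of `f^* P` is that of a submanifold of `P × (ℝ^{d+1} \ {0})`: a map into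
`f^* P` is smooth if and only if it is smooth as a map into the product. -/
theorem contMDiffOn_pullback_iff {E H X : Type*} [NormedAddCommGroup E] [NormedSpace ℝ E]
    [TopologicalSpace H] {I : ModelWithCorners ℝ E H} [TopologicalSpace X] [ChartedSpace H X]
    (u : X → B.Pullback) (s : Set X) :
    ContMDiffOn I (IP.prod 𝓘(ℝ, ℝ)) ∞ u s ↔
      ContMDiffOn I (IP.prod (𝓡 (d + 1))) ∞ (fun x => B.pullbackIncl (u x)) s := by
  constructor
  · intro h
    exact (B.contMDiff_toP.comp_contMDiffOn h).prodMk (B.contMDiff_base.comp_contMDiffOn h)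
  · intro h
    have h1 : ContMDiffOn I IP ∞ (fun x => (u x).toP) s := contMDiff_fst.comp_contMDiffOn h
    have h0 : ContMDiffOn I (𝓡 (d + 1)) ∞ (fun x => (u x).base) s :=
      contMDiff_snd.comp_contMDiffOn h
    have h2 : ContMDiffOn I (𝓡 (d + 1)) ∞ (fun x => (u x).base.1) s :=
      contMDiff_subtype_val.comp_contMDiffOn h0
    have h3 : ContMDiffOn I 𝓘(ℝ, ℝ) ∞ (fun x => Real.log ‖(u x).base.1‖) s := by
      intro x hx
      have : ContDiffAt ℝ ∞ (fun y : EuclideanSpace ℝ (Fin (d + 1)) => Real.log ‖y‖)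
          (u x).base.1 :=
        (contDiffAt_norm ℝ (u x).base.2).log (punctured_norm_pos _).ne'
      exact this.contMDiffAt.comp_contMDiffWithinAt x (h2 x hx)
    have h4 : ContMDiffOn I (IP.prod 𝓘(ℝ, ℝ)) ∞
        (fun x => B.pullbackHomeo.symm (B.pullbackHomeo (u x))) s :=
      B.contMDiff_pullbackHomeo_symm.comp_contMDiffOn (h1.prodMk h3)
    simpa only [Homeomorph.symm_apply_apply] using h4

theorem pullback_locally_trivial (x : Punctured (d + 1)) :
    ∃ (U : Set (Punctured (d + 1))) (ψ : Punctured (d + 1) × G → B.Pullback)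
      (γ : B.Pullback → G), IsOpen U ∧ x ∈ U ∧
    ContMDiffOn ((𝓡 (d + 1)).prod IG) (IP.prod 𝓘(ℝ, ℝ)) ∞ ψ (U ×ˢ univ) ∧
    ContMDiffOn (IP.prod 𝓘(ℝ, ℝ)) IG ∞ γ (Pullback.base ⁻¹' U) ∧
    (∀ y ∈ U, ∀ g, (ψ (y, g)).base = y ∧ γ (ψ (y, g)) = g) ∧
    (∀ q : B.Pullback, q.base ∈ U → ψ (q.base, γ q) = q) ∧
    ∀ y ∈ U, ∀ g h, (⟨B.act (ψ (y, g)).toP h, (ψ (y, g)).base,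
      (B.proj_act _ _).trans (ψ (y, g)).proj_eq⟩ : B.Pullback) = ψ (y, g * h) := by
  obtain ⟨U, ψ, γ, hU, hx, hψ, hγ, h1, h2, h3⟩ := B.locally_trivial (radial d x)
  have hex : ∀ z : Punctured (d + 1) × G, ∃ q : B.Pullback, radial d z.1 ∈ U →
      q.toP = ψ (radial d z.1, z.2) ∧ q.base = z.1 := fun z => by
    by_cases hz : radial d z.1 ∈ U
    · exact ⟨⟨ψ (radial d z.1, z.2), z.1, (h1 _ hz z.2).1⟩, fun _ => ⟨rfl, rfl⟩⟩
    · exact ⟨⟨ψ (radial d x, 1), x, (h1 _ hx 1).1⟩, fun h => absurd h hz⟩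
  choose ψ' hψ' using hex
  refine ⟨radial d ⁻¹' U, ψ', fun q => γ q.toP, hU.preimage (contMDiff_radial d).continuous, hx,
    ?_, ?_, ?_, ?_, ?_⟩
  · rw [contMDiffOn_pullback_iff]
    have h5 : ContMDiffOn ((𝓡 (d + 1)).prod IG) (IP.prod (𝓡 (d + 1))) ∞
        (fun z : Punctured (d + 1) × G => (ψ (radial d z.1, z.2), z.1))
        ((radial d ⁻¹' U) ×ˢ univ) := by
      refine ContMDiffOn.prodMk ?_ contMDiffOn_fst
      exact hψ.comp ((((contMDiff_radial d).comp contMDiff_fst).prodMk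
        contMDiff_snd).contMDiffOn) fun z hz => ⟨hz.1, mem_univ _⟩
    exact h5.congr fun z hz => Prod.ext (hψ' z hz.1).1 (hψ' z hz.1).2
  · refine hγ.comp B.contMDiff_toP.contMDiffOn fun q hq => ?_
    change B.proj q.toP ∈ U
    rw [q.proj_eq]; exact hq
  · intro y hy g
    refine ⟨(hψ' (y, g) hy).2, ?_⟩
    change γ (ψ' (y, g)).toP = g
    rw [(hψ' (y, g) hy).1]; exact (h1 _ hy g).2
  · intro q hq
    have hq' : radial d q.base ∈ U := hq
    obtain ⟨e1, e2⟩ := hψ' (q.base, γ q.toP) hq'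
    refine Pullback.ext (e1.trans ?_) e2
    change ψ (radial d q.base, γ q.toP) = q.toP
    rw [← q.proj_eq] at hq' ⊢
    exact h2 _ hq'
  · intro y hy g h
    refine Pullback.ext ?_ ?_
    · change B.act (ψ' (y, g)).toP h = (ψ' (y, g * h)).toP
      rw [(hψ' (y, g) hy).1, (hψ' (y, g * h) hy).1]; exact h3 _ hy g h
    · change (ψ' (y, g)).base = (ψ' (y, g * h)).base
      rw [(hψ' (y, g) hy).2, (hψ' (y, g * h) hy).2]

/-- The pullback `F^* φ` of a form on `P` under the bundle homomorphism `F : f^* P → P`. -/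
def pullbackForm {V : Type*} [NormedAddCommGroup V] [NormedSpace ℝ V] {k : ℕ}
    (φ : DForm IP P k V) : DForm (IP.prod 𝓘(ℝ, ℝ)) B.Pullback k V :=
  DForm.pullback (IP.prod 𝓘(ℝ, ℝ)) (Pullback.toP : B.Pullback → P) φ

/-- The pullback bundle `f^* P → ℝ^{d+1} \ {0}`, with the action `(p, x) · g = (p · g, x)`. -/
def pullbackBundle :
    PrincipalBundle IG G (IP.prod 𝓘(ℝ, ℝ)) B.Pullback (𝓡 (d + 1)) (Punctured (d + 1)) where
  proj := Pullback.base
  act q g := ⟨B.act q.toP g, q.base, (B.proj_act _ _).trans q.proj_eq⟩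
  act_one _ := Pullback.ext (B.act_one _) rfl
  act_mul _ _ _ := Pullback.ext (B.act_mul _ _ _) rfl
  proj_act _ _ := rfl
  contMDiff_proj := B.contMDiff_base
  contMDiff_act := by
    rw [← contMDiffOn_univ, contMDiffOn_pullback_iff, contMDiffOn_univ]
    have h1 : ContMDiff ((IP.prod 𝓘(ℝ, ℝ)).prod IG) (IP.prod IG) ∞
        fun z : B.Pullback × G => (z.1.toP, z.2) :=
      (B.contMDiff_toP.comp contMDiff_fst).prodMk contMDiff_snd
    have h2 : ContMDiff ((IP.prod 𝓘(ℝ, ℝ)).prod IG) (𝓡 (d + 1)) ∞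
        fun z : B.Pullback × G => z.1.base := B.contMDiff_base.comp contMDiff_fst
    exact (B.contMDiff_act.comp h1).prodMk h2
  locally_trivial := B.pullback_locally_trivial

end PrincipalBundle

end

/-!
Punctured space `ℝ^{d+1} \ {0}` is the metric cone over the sphere `𝕊^d`: with `r = ‖x‖`, with the
radial projection `f`, the round metric `g` and its volume form `μ`, one has `dx² = dr² + r² f^*g`
and `dx¹ ∧ … ∧ dx^{d+1} = r^d dr ∧ f^*μ` (`exists_isConeData_radial`). The Hodge star of a cone is
computed pointwise in an orthonormal basis consisting of the radial direction and of rescaled lifts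
from the sphere: for a form `α` of degree `k` on the sphere,
`∗f^*α = (-1)^k r^{d-2k} dr ∧ f^*(∗α)` and `∗(dr ∧ f^*α) = r^{d-2k} f^*(∗α)`
(`IsConeData.hodgeStar_pullback`, `IsConeData.hodgeStar_wedgeCovector`). The choice of basis in the
definition of the Hodge star does not matter (`hodgeStar_apply_of_orthonormal`).

The total space of the pullback bundle is `P × ℝ` with second coordinate `t = log r`, and the bundle
homomorphism `F` is the projection to `P`, also in the preferred charts. Hence `d` and `D` commute
with `F^*`, and `D(e^{ct} dt ∧ F^*ψ) = -e^{ct} dt ∧ F^*(Dψ)` (`covD_pullbackForm`, `covD_expWedge`).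
Horizontal lifts are unique because a fundamental vector field is determined by its value under the
connection, so `F` maps horizontal lifts to horizontal lifts (`mfderiv_toP_lift`), and the pointwise
formulas for the Hodge star hold upstairs (`star_pullbackForm`, `star_expWedge`). For the curvature
`Ω`, of degree `2`, and `dr = r dt` they give
`∗F^*Ω = r^{d-3} dt ∧ F^*(∗Ω)`, then `D∗F^*Ω = -r^{d-3} dt ∧ F^*(D∗Ω)`, and, `D∗Ω` being of degree
`d - 1`, finally `∗D∗F^*Ω = -r^{d-3} r^{1-d} F^*(∗D∗Ω) = -r^{-2} F^*(∗D∗Ω)`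
(`starDStar_pullbackForm`). The two signs in the codifferentials differ since `d = 2n` is even and
`d + 1` is odd, and `F` is a submersion onto `P`, so that `F^*` detects the vanishing of a form.

The rules for the exterior derivative under `F^*` hold for all forms, differentiable or not: at a
point where a form is not differentiable in a chart neither is the corresponding form on `P × ℝ`,
and then both exterior derivatives are `0`.
-/

/-! ### Sums over increasing multi-indices -/

section MultiIndex

/-- A symmetric function of multi-indices that vanishes on multi-indices with repetitions has, up
to the factor `k!`, the same sum over all multi-indices as over the increasing ones. -/
theorem sum_eq_factorial_nsmul_sum_orderEmb {V : Type*} [AddCommMonoid V]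
    {k m : ℕ} (Q : (Fin k → Fin m) → V)
    (hinj : ∀ s, ¬ Function.Injective s → Q s = 0)
    (hperm : ∀ s, ∀ σ : Equiv.Perm (Fin k), Q (s ∘ σ) = Q s) :
    ∑ s, Q s = k.factorial • ∑ s : Fin k ↪o Fin m, Q s := by
  classical
  have h1 : ∑ s, Q s = ∑ z : Equiv.Perm (Fin k) × (Fin k ↪o Fin m), Q (z.2 ∘ z.1) := by
    symm
    refine Finset.sum_of_injOn (fun z => (z.2 : Fin k → Fin m) ∘ z.1) ?_ ?_ ?_ ?_
    · rintro ⟨σ, s⟩ - ⟨σ', s'⟩ - h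
      have h : (s : Fin k → Fin m) ∘ σ = s' ∘ σ' := h
      have hr : range (s : Fin k → Fin m) = range s' := by
        rw [← σ.surjective.range_comp (s : Fin k → Fin m), h, σ'.surjective.range_comp]
      obtain rfl : s = s' := OrderEmbedding.range_inj.1 hr
      have : σ = σ' := Equiv.ext fun i => s.injective (congrFun h i)
      rw [this]
    · exact fun _ _ => Finset.mem_coe.2 (Finset.mem_univ _)
    · intro s _ hs
      refine hinj s fun hi => hs ?_
      have hm : StrictMono (s ∘ Tuple.sort s) :=
        (Tuple.monotone_sort s).strictMono_of_injective (hi.comp (Equiv.injective _))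
      refine ⟨((Tuple.sort s)⁻¹, OrderEmbedding.ofStrictMono _ hm), by simp, ?_⟩
      funext i
      simp [OrderEmbedding.coe_ofStrictMono]
    · exact fun _ _ => rfl
  rw [h1, Fintype.sum_prod_type]
  simp [hperm, Fintype.card_perm]

/-- Increasing multi-indices in `Fin (m + 1)` either start with `0` or avoid it. -/
theorem sum_orderEmb_succ {V : Type*} [AddCommMonoid V] {k m : ℕ}
    (Q : (Fin (k + 1) → Fin (m + 1)) → V) :
    ∑ s : Fin (k + 1) ↪o Fin (m + 1), Q s =
      ∑ s : Fin k ↪o Fin m, Q (Fin.cons 0 (Fin.succ ∘ s)) +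
        ∑ s : Fin (k + 1) ↪o Fin m, Q (Fin.succ ∘ s) := by
  have hcons : ∀ s : Fin k ↪o Fin m,
      StrictMono (Fin.cons 0 (Fin.succ ∘ s) : Fin (k + 1) → Fin (m + 1)) := by
    intro s i j hij
    obtain ⟨j, rfl⟩ := Fin.exists_succ_eq.2 ((Fin.zero_le i).trans_lt hij).ne'
    revert hij
    refine Fin.cases (fun _ => ?_) (fun i hij => ?_) i
    · simp
    · simpa using hij
  let Φ : (Fin k ↪o Fin m) ⊕ (Fin (k + 1) ↪o Fin m) → (Fin (k + 1) ↪o Fin (m + 1)) :=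
    Sum.elim (fun s => OrderEmbedding.ofStrictMono _ (hcons s))
      (fun s => s.trans (Fin.succOrderEmb m))
  have hΦ : Function.Bijective Φ := by
    constructor
    · rintro (s | s) (s' | s') h
      · congr 1
        ext i
        have := congrArg Fin.val (DFunLike.congr_fun h i.succ)
        simpa [Φ, OrderEmbedding.coe_ofStrictMono] using this
      · have := DFunLike.congr_fun h 0
        simp [Φ, OrderEmbedding.coe_ofStrictMono] at this
        exact absurd this.symm (Fin.succ_ne_zero _)
      · have := DFunLike.congr_fun h 0
        simp [Φ, OrderEmbedding.coe_ofStrictMono] at this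
      · congr 1
        ext i
        have := congrArg Fin.val (DFunLike.congr_fun h i)
        simpa [Φ] using this
    · intro s
      by_cases h0 : s 0 = 0
      · have hne : ∀ i : Fin k, s i.succ ≠ 0 := fun i h => by
          have := s.strictMono (Fin.succ_pos i)
          rw [h, h0] at this
          exact lt_irrefl _ this
        refine ⟨Sum.inl (OrderEmbedding.ofStrictMono (fun i => (s i.succ).pred (hne i)) ?_), ?_⟩
        · intro i j hij
          simpa using hij
        · ext i
          refine Fin.cases ?_ (fun i => ?_) i
          · simp [Φ, OrderEmbedding.coe_ofStrictMono, h0]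
          · exact congrArg Fin.val (Fin.succ_pred (s i.succ) (hne i))
      · have hne : ∀ i : Fin (k + 1), s i ≠ 0 := fun i h => by
          have := s.monotone (Fin.zero_le i)
          rw [h] at this
          exact h0 (Fin.le_zero_iff.1 this)
        refine ⟨Sum.inr (OrderEmbedding.ofStrictMono (fun i => (s i).pred (hne i)) ?_), ?_⟩
        · intro i j hij
          simpa using hij
        · ext i
          exact congrArg Fin.val (Fin.succ_pred (s i) (hne i))
  rw [← Fintype.sum_bijective Φ hΦ (fun z => Q (Φ z)) _ (fun _ => rfl), Fintype.sum_sum_type]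
  rfl

/-- The full contraction of two multilinear maps does not change when the vectors are replaced by
their images under an orthogonal matrix. -/
theorem sum_multilinear_orthogonal {V : Type*} [AddCommGroup V] [Module ℝ V] {T : Type*} [AddCommGroup T] [Module ℝ T] {k m : ℕ}
    (M : MultilinearMap ℝ (fun _ : Fin k => T) ℝ) (N : MultilinearMap ℝ (fun _ : Fin k => T) V)
    (e e' : Fin m → T) (O : Matrix (Fin m) (Fin m) ℝ) (hO : O.transpose * O = 1)
    (he : ∀ j, e' j = ∑ a, O j a • e a) :
    ∑ s : Fin k → Fin m, M (e' ∘ s) • N (e' ∘ s) =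
      ∑ s : Fin k → Fin m, M (e ∘ s) • N (e ∘ s) := by
  classical
  have hM : ∀ s : Fin k → Fin m,
      M (e' ∘ s) = ∑ a : Fin k → Fin m, (∏ i, O (s i) (a i)) • M (e ∘ a) := by
    intro s
    have : e' ∘ s = fun i => ∑ a, O (s i) a • e a := funext fun i => he _
    rw [this, MultilinearMap.map_sum]
    exact Finset.sum_congr rfl fun a _ => M.map_smul_univ _ _
  have hN : ∀ s : Fin k → Fin m,
      N (e' ∘ s) = ∑ a : Fin k → Fin m, (∏ i, O (s i) (a i)) • N (e ∘ a) := by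
    intro s
    have : e' ∘ s = fun i => ∑ a, O (s i) a • e a := funext fun i => he _
    rw [this, MultilinearMap.map_sum]
    exact Finset.sum_congr rfl fun a _ => N.map_smul_univ _ _
  have hδ : ∀ a b : Fin k → Fin m,
      ∑ s : Fin k → Fin m, (∏ i, O (s i) (a i)) * ∏ i, O (s i) (b i) = if a = b then 1 else 0 := by
    intro a b
    have h1 : ∀ i, ∑ j, O j (a i) * O j (b i) = if a i = b i then 1 else 0 := by
      intro i
      have := congrFun (congrFun hO (a i)) (b i)
      simpa [Matrix.mul_apply, Matrix.one_apply] using this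
    simp only [← Finset.prod_mul_distrib]
    rw [← Fintype.prod_sum (fun i j => O j (a i) * O j (b i))]
    simp only [h1]
    by_cases hab : a = b
    · simp [hab]
    · rw [if_neg hab]
      obtain ⟨i, hi⟩ := Function.ne_iff.1 hab
      exact Finset.prod_eq_zero (Finset.mem_univ i) (if_neg hi)
  calc ∑ s : Fin k → Fin m, M (e' ∘ s) • N (e' ∘ s)
      = ∑ s : Fin k → Fin m, ∑ a : Fin k → Fin m, ∑ b : Fin k → Fin m,
          ((∏ i, O (s i) (a i)) * ∏ i, O (s i) (b i)) • (M (e ∘ a) • N (e ∘ b)) := by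
        refine Finset.sum_congr rfl fun s _ => ?_
        rw [hM, hN, Finset.sum_smul]
        refine Finset.sum_congr rfl fun a _ => ?_
        rw [Finset.smul_sum]
        refine Finset.sum_congr rfl fun b _ => ?_
        simp only [smul_smul, smul_eq_mul]
        congr 1
        ring
    _ = ∑ a : Fin k → Fin m, ∑ b : Fin k → Fin m,
          (∑ s : Fin k → Fin m, (∏ i, O (s i) (a i)) * ∏ i, O (s i) (b i)) •
            (M (e ∘ a) • N (e ∘ b)) := by
        rw [Finset.sum_comm]
        refine Finset.sum_congr rfl fun a _ => ?_
        rw [Finset.sum_comm]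
        refine Finset.sum_congr rfl fun b _ => ?_
        rw [Finset.sum_smul]
    _ = ∑ s : Fin k → Fin m, M (e ∘ s) • N (e ∘ s) := by
        simp only [hδ, ite_smul, one_smul, zero_smul, Finset.sum_ite_eq, Finset.mem_univ, if_true]

end MultiIndex

/-! ### The Hodge star in an arbitrary orthonormal basis -/

section HodgeBasis

theorem append_update_left_cast {T : Type*} {k l m : ℕ} (h : k + l = m) (u : Fin k → T)
    (v : Fin l → T) (i : Fin k) (x : T) :
    (fun j : Fin m => Fin.append (Function.update u i x) v (Fin.cast h.symm j)) =
      Function.update (fun j : Fin m => Fin.append u v (Fin.cast h.symm j))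
        (Fin.cast h (Fin.castAdd l i)) x := by
  subst h
  funext j
  refine Fin.addCases (fun a => ?_) (fun a => ?_) j
  · by_cases hai : a = i
    · subst hai; simp
    · have : Fin.castAdd l a ≠ Fin.castAdd l i := fun hh => hai (by simpa using hh)
      simp [Function.update, hai]
  · have : Fin.natAdd k a ≠ Fin.castAdd l i := by
      intro hh; have := congrArg Fin.val hh; simp at this; omega
    simp [Function.update, this]

variable {T V : Type*} [AddCommGroup T] [Module ℝ T] [TopologicalSpace T]
  [NormedAddCommGroup V] [NormedSpace ℝ V] {k l m : ℕ}

theorem contract_apply (h : k + l = m) (μ : T [⋀^Fin m]→L[ℝ] ℝ) (u : Fin k → T)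
    (v : Fin l → T) :
    contract h μ u v = μ fun j => Fin.append u v (Fin.cast h.symm j) := rfl

/-- The form `u ↦ μ (u₁, …, u_k, v₁, …, v_l)`, the counterpart of `contract` with the last
arguments fixed. -/
noncomputable def contractHead (h : k + l = m) (μ : T [⋀^Fin m]→L[ℝ] ℝ) (v : Fin l → T) :
    T [⋀^Fin k]→ₗ[ℝ] ℝ where
  toFun u := contract h μ u v
  map_update_add' := by
    intro inst u i x y
    obtain rfl : inst = instDecidableEqFin k := Subsingleton.elim _ _
    simp only [contract_apply, append_update_left_cast h]
    exact μ.map_update_add _ _ _ _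
  map_update_smul' := by
    intro inst u i c x
    obtain rfl : inst = instDecidableEqFin k := Subsingleton.elim _ _
    simp only [contract_apply, append_update_left_cast h]
    exact μ.map_update_smul _ _ _ _
  map_eq_zero_of_eq' u i j hu hij := by
    refine μ.map_eq_zero_of_eq _ (i := Fin.cast h (Fin.castAdd l i))
      (j := Fin.cast h (Fin.castAdd l j)) (by simpa using hu) ?_
    intro hh
    exact hij (by simpa using hh)

theorem contractHead_apply (h : k + l = m) (μ : T [⋀^Fin m]→L[ℝ] ℝ) (u : Fin k → T)
    (v : Fin l → T) : contractHead h μ v u = contract h μ u v := rfl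

theorem contract_const_smul (h : k + l = m) (μ : T [⋀^Fin m]→L[ℝ] ℝ) (c : ℝ) (u : Fin k → T)
    (v : Fin l → T) : contract h μ (fun i => c • u i) v = c ^ k * contract h μ u v := by
  simpa [contractHead_apply] using
    (contractHead h μ v).toMultilinearMap.map_smul_univ (fun _ => c) u

theorem hodgeStar_apply (g : T → T → ℝ) (μ : T [⋀^Fin m]→L[ℝ] ℝ) (h : k + l = m)
    (α : T [⋀^Fin k]→L[ℝ] V) (v : Fin l → T) :
    ∃ e : Fin m → T, e = (Classical.epsilon fun e => ∀ i j, g (e i) (e j) = if i = j then 1 else 0)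
      ∧ hodgeStar g μ h α v = ∑ s : Fin k ↪o Fin m, contract h μ (e ∘ s) v • α (e ∘ s) := by
  refine ⟨_, rfl, ?_⟩
  rw [hodgeStar]
  simp [ContinuousAlternatingMap.sum_apply]

/-- The Hodge star may be computed in any orthonormal basis: up to the factor `k!` the sum defining
it is a full contraction, which is invariant under orthogonal matrices. -/
theorem hodgeStar_apply_of_orthonormal (g : LinearMap.BilinForm ℝ T) (μ : T [⋀^Fin m]→L[ℝ] ℝ)
    (h : k + l = m) (α : T [⋀^Fin k]→L[ℝ] V) (e : Fin m → T)
    (he : ∀ i j, g (e i) (e j) = if i = j then 1 else 0)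
    (hspan : ∀ x, ∃ c : Fin m → ℝ, x = ∑ a, c a • e a) (v : Fin l → T) :
    hodgeStar (fun x y => g x y) μ h α v =
      ∑ s : Fin k ↪o Fin m, contract h μ (e ∘ s) v • α (e ∘ s) := by
  obtain ⟨e', he', heq⟩ := hodgeStar_apply (fun x y => g x y) μ h α v
  have horth : ∀ i j, g (e' i) (e' j) = if i = j then 1 else 0 := by
    rw [he']
    exact Classical.epsilon_spec (p := fun e : Fin m → T =>
      ∀ i j, g (e i) (e j) = if i = j then 1 else 0) ⟨e, he⟩
  choose O hO using fun j => hspan (e' j)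
  have hOO : Matrix.of O * (Matrix.of O).transpose = 1 := by
    ext i j
    have := horth i j
    rw [hO i, hO j] at this
    simp only [map_sum, map_smul, LinearMap.sum_apply, LinearMap.smul_apply, he] at this
    simpa [Matrix.mul_apply, Matrix.one_apply, mul_comm] using this
  have key := sum_multilinear_orthogonal (contractHead h μ v).toMultilinearMap
    α.toMultilinearMap e e' (Matrix.of O) (mul_eq_one_comm.1 hOO) hO
  have hsum : ∀ e : Fin m → T,
      ∑ s : Fin k → Fin m, contract h μ (e ∘ s) v • α (e ∘ s) =
        k.factorial • ∑ s : Fin k ↪o Fin m, contract h μ (e ∘ s) v • α (e ∘ s) := by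
    intro e
    refine sum_eq_factorial_nsmul_sum_orderEmb
      (fun s : Fin k → Fin m => contract h μ (e ∘ s) v • α (e ∘ s)) ?_ ?_
    · intro s hs
      have : ¬ Function.Injective (e ∘ s) := fun hi => hs hi.of_comp
      have h0 : α (e ∘ s) = 0 := α.toAlternatingMap.map_eq_zero_of_not_injective _ this
      simp [h0]
    · intro s σ
      have h1 : contract h μ ((e ∘ s) ∘ σ) v = Equiv.Perm.sign σ • contract h μ (e ∘ s) v :=
        (contractHead h μ v).map_perm (e ∘ s) σ
      have h2 : α ((e ∘ s) ∘ σ) = Equiv.Perm.sign σ • α (e ∘ s) :=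
        α.toAlternatingMap.map_perm (e ∘ s) σ
      change contract h μ ((e ∘ s) ∘ σ) v • α ((e ∘ s) ∘ σ) = _
      rw [h1, h2]
      rcases Int.units_eq_one_or (Equiv.Perm.sign σ) with hσ | hσ <;> simp [hσ]
  have key' : k.factorial • ∑ s : Fin k ↪o Fin m, contract h μ (e' ∘ s) v • α (e' ∘ s) =
      k.factorial • ∑ s : Fin k ↪o Fin m, contract h μ (e ∘ s) v • α (e ∘ s) := by
    rw [← hsum, ← hsum]
    exact key
  rw [heq]
  have hk : (k.factorial : ℝ) ≠ 0 := by exact_mod_cast k.factorial_ne_zero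
  rw [← Nat.cast_smul_eq_nsmul ℝ, ← Nat.cast_smul_eq_nsmul ℝ] at key'
  exact smul_right_injective _ hk key'

theorem hodgeStar_smul (g : T → T → ℝ) (μ : T [⋀^Fin m]→L[ℝ] ℝ) (h : k + l = m) (c : ℝ)
    (α : T [⋀^Fin k]→L[ℝ] V) : hodgeStar g μ h (c • α) = c • hodgeStar g μ h α := by
  ext v
  simp only [hodgeStar, ContinuousAlternatingMap.sum_apply, ContinuousAlternatingMap.smul_apply,
    ContinuousAlternatingMap.smulRight_apply, Finset.smul_sum]
  exact Finset.sum_congr rfl fun s _ => smul_comm _ _ _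

end HodgeBasis

/-! ### The wedge product with a covector -/

section Wedge

variable {T V : Type*} [AddCommGroup T] [Module ℝ T] [TopologicalSpace T]
  [NormedAddCommGroup V] [NormedSpace ℝ V] {k l m : ℕ}

/-- The wedge product `ℓ ∧ φ` of a covector with a form,
`(ℓ ∧ φ)(v₀, …, v_k) = ∑ᵢ (-1)ⁱ ℓ(vᵢ) φ(v₀, …, v̂ᵢ, …, v_k)`. -/
noncomputable def wedgeCovector (ℓ : T →L[ℝ] ℝ) (φ : T [⋀^Fin k]→L[ℝ] V) :
    T [⋀^Fin (k + 1)]→L[ℝ] V where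
  __ := AlternatingMap.alternatizeUncurryFin
    ((ℓ : T →ₗ[ℝ] ℝ).smulRight φ.toAlternatingMap)
  cont := by
    change Continuous fun v => AlternatingMap.alternatizeUncurryFin
      ((ℓ : T →ₗ[ℝ] ℝ).smulRight φ.toAlternatingMap) v
    simp only [AlternatingMap.alternatizeUncurryFin_apply]
    refine continuous_finsetSum _ fun i _ => ?_
    have hc : Continuous fun v : Fin (k + 1) → T => ℓ (v i) • φ (i.removeNth v) := (ℓ.continuous.comp (continuous_apply i)).smul
      (φ.coe_continuous.comp (continuous_pi fun j => continuous_apply _))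
    exact hc.const_smul ((-1 : ℤ) ^ (i : ℕ))

theorem wedgeCovector_apply (ℓ : T →L[ℝ] ℝ) (φ : T [⋀^Fin k]→L[ℝ] V) (v : Fin (k + 1) → T) :
    wedgeCovector ℓ φ v = ∑ i : Fin (k + 1), (-1 : ℝ) ^ (i : ℕ) • ℓ (v i) • φ (i.removeNth v) := by
  refine (AlternatingMap.alternatizeUncurryFin_apply _ _).trans
    (Finset.sum_congr rfl fun i _ => ?_)
  change (-1 : ℤ) ^ (i : ℕ) • ℓ (v i) • φ (i.removeNth v) = _
  rcases neg_one_pow_eq_or ℤ (i : ℕ) with h | h <;>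
    rcases Nat.even_or_odd (i : ℕ) with h' | h' <;> simp [h'.neg_one_pow]

theorem wedgeCovector_compContinuousLinearMap {T' : Type*} [AddCommGroup T'] [Module ℝ T']
    [TopologicalSpace T'] (f : T' →L[ℝ] T) (ℓ : T →L[ℝ] ℝ) (φ : T [⋀^Fin k]→L[ℝ] V) :
    (wedgeCovector ℓ φ).compContinuousLinearMap f =
      wedgeCovector (ℓ.comp f) (φ.compContinuousLinearMap f) := by
  ext v
  simp only [wedgeCovector_apply, ContinuousAlternatingMap.compContinuousLinearMap_apply]
  rfl

/-- A form `μ` of top degree equals `ℓ ∧ ι_x μ` whenever `ℓ x = 1`: apply `ι_x` to `ℓ ∧ μ = 0`. -/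
theorem eq_wedgeCovector_curryLeft {E : Type*} [NormedAddCommGroup E] [NormedSpace ℝ E]
    [FiniteDimensional ℝ E] (hE : Module.finrank ℝ E = m + 1) (μ : E [⋀^Fin (m + 1)]→L[ℝ] ℝ)
    (ℓ : E →L[ℝ] ℝ) (x : E) (hx : ℓ x = 1) : μ = wedgeCovector ℓ (μ.curryLeft x) := by
  ext w
  have h0 : wedgeCovector ℓ μ (Fin.cons x w) = 0 := by
    refine (wedgeCovector ℓ μ).toAlternatingMap.map_linearDependent _ fun hli => ?_
    have := hli.fintype_card_le_finrank
    simp [hE] at this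
  rw [wedgeCovector_apply, Fin.sum_univ_succ] at h0
  have h1 : ∀ i : Fin (m + 1), i.succ.removeNth (Fin.cons x w : Fin (m + 2) → E) =
      Matrix.vecCons x (i.removeNth w) := by
    intro i
    funext j
    refine Fin.cases ?_ (fun j => ?_) j
    · simp [Fin.removeNth]
    · simp [Fin.removeNth]
  rw [wedgeCovector_apply]
  simp only [h1, Fin.cons_succ, Fin.val_succ, Fin.cons_zero, hx, Fin.val_zero, pow_zero, one_smul,
    pow_succ, mul_neg_one, neg_smul, Finset.sum_neg_distrib] at h0
  have h2 : (0 : Fin (m + 2)).removeNth (Fin.cons x w : Fin (m + 2) → E) = w := by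
    funext j
    simp [Fin.removeNth]
  rw [h2] at h0
  exact add_neg_eq_zero.1 h0

end Wedge

/-! ### The Hodge star on a cone -/

section Cone

variable {T T' V : Type*} [AddCommGroup T] [Module ℝ T] [TopologicalSpace T]
  [AddCommGroup T'] [Module ℝ T'] [TopologicalSpace T']
  [NormedAddCommGroup V] [NormedSpace ℝ V] {k l d : ℕ}

theorem removeNth_natAdd_append {T : Type*} {k l : ℕ} (u : Fin k → T) (v : Fin (l + 1) → T)
    (j : Fin (l + 1)) :
    Fin.removeNth (n := k + l) (α := fun _ => T) (Fin.natAdd k j)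
      (Fin.append (m := k) (n := l + 1) u v) = Fin.append u (j.removeNth v) := by
  funext i
  refine Fin.addCases (fun a => ?_) (fun a => ?_) i
  · have h : (Fin.natAdd k j : Fin (k + l + 1)).succAbove (Fin.castAdd l a) =
        Fin.castAdd (l + 1) a := by
      refine (Fin.succAbove_of_castSucc_lt _ _ ?_).trans ?_
      · rw [Fin.lt_def]; simp; omega
      · ext; simp
    change Fin.append (m := k) (n := l + 1) u v ((Fin.natAdd k j : Fin (k + l + 1)).succAbove (Fin.castAdd l a)) = _
    rw [h]; simp
  · have h : (Fin.natAdd k j : Fin (k + l + 1)).succAbove (Fin.natAdd k a) =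
        Fin.natAdd k (j.succAbove a) := by
      by_cases hja : a.castSucc < j
      · rw [Fin.succAbove_of_castSucc_lt _ _ hja]
        refine (Fin.succAbove_of_castSucc_lt _ _ ?_).trans ?_
        · rw [Fin.lt_def] at hja ⊢; simp at hja ⊢; omega
        · ext; simp
      · rw [Fin.succAbove_of_le_castSucc _ _ (not_lt.1 hja)]
        refine (Fin.succAbove_of_le_castSucc _ _ ?_).trans ?_
        · rw [not_lt, Fin.le_def] at hja; rw [Fin.le_def]; simp at hja ⊢; omega
        · ext; simp; omega
    change Fin.append (m := k) (n := l + 1) u v ((Fin.natAdd k j : Fin (k + l + 1)).succAbove (Fin.natAdd k a)) = _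
    rw [h]; simp [Fin.removeNth]

/-- Pointwise data of a metric cone: `g' = ℓ² + r² f^*g` and `μ' = r^d ℓ ∧ f^*μ` on `T'`, where
`(ℓ, f) : T' → ℝ × T` is an isomorphism, and `e` is an orthonormal basis of the `d`-dimensional
space `T`. Here `r` is the radius and `ℓ` stands for `dr`. -/
structure IsConeData (g : LinearMap.BilinForm ℝ T) (μ : T [⋀^Fin d]→L[ℝ] ℝ)
    (g' : LinearMap.BilinForm ℝ T') (μ' : T' [⋀^Fin (d + 1)]→L[ℝ] ℝ)
    (f : T' →L[ℝ] T) (ℓ : T' →L[ℝ] ℝ) (r : ℝ) (e : Fin d → T) : Prop where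
  pos : r ≠ 0
  orthonormal : ∀ i j, g (e i) (e j) = if i = j then 1 else 0
  span : ∀ x, ∃ c : Fin d → ℝ, x = ∑ a, c a • e a
  metric : ∀ u v, g' u v = ℓ u * ℓ v + r ^ 2 * g (f u) (f v)
  volume : μ' = r ^ d • wedgeCovector ℓ (μ.compContinuousLinearMap f)
  injective : ∀ w, ℓ w = 0 → f w = 0 → w = 0
  surjective : ∀ (a : ℝ) (u : T), ∃ w, ℓ w = a ∧ f w = u

variable {g : LinearMap.BilinForm ℝ T} {μ : T [⋀^Fin d]→L[ℝ] ℝ}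
  {g' : LinearMap.BilinForm ℝ T'} {μ' : T' [⋀^Fin (d + 1)]→L[ℝ] ℝ}
  {f : T' →L[ℝ] T} {ℓ : T' →L[ℝ] ℝ} {r : ℝ} {e : Fin d → T}

/-- An orthonormal basis of a cone: the unit radial vector and the lifts, scaled by `1 / r`, of an
orthonormal basis of the base. -/
theorem IsConeData.exists_basis (H : IsConeData g μ g' μ' f ℓ r e) :
    ∃ e' : Fin (d + 1) → T', (∀ i j, g' (e' i) (e' j) = if i = j then 1 else 0) ∧
      (∀ x, ∃ c : Fin (d + 1) → ℝ, x = ∑ a, c a • e' a) ∧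
      ℓ (e' 0) = 1 ∧ f (e' 0) = 0 ∧ (∀ i : Fin d, ℓ (e' i.succ) = 0) ∧
      ∀ i : Fin d, f (e' i.succ) = r⁻¹ • e i := by
  obtain ⟨x₀, h1, h2⟩ := H.surjective 1 0
  choose E h3 h4 using fun i => H.surjective 0 (r⁻¹ • e i)
  refine ⟨Fin.cons x₀ E, ?_, ?_, by simpa using h1, by simpa using h2, by simpa using h3,
    by simpa using h4⟩
  · intro i j
    rw [H.metric]
    refine Fin.cases ?_ (fun i => ?_) i <;> refine Fin.cases ?_ (fun j => ?_) j
    · simp [h1, h2]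
    · simp [h1, h2, h3, (Fin.succ_ne_zero j).symm]
    · simp [h1, h2, h3]
    · have hr := H.pos
      simp only [Fin.cons_succ, h3, h4, map_smul, LinearMap.smul_apply, H.orthonormal,
        Fin.succ_inj]
      split_ifs
      · simp; field_simp
      · simp
  · intro x
    obtain ⟨c, hc⟩ := H.span (f x)
    refine ⟨Fin.cons (ℓ x) fun i => r * c i, ?_⟩
    rw [Fin.sum_univ_succ]
    simp only [Fin.cons_zero, Fin.cons_succ]
    refine sub_eq_zero.1 (H.injective _ ?_ ?_)
    · simp [map_sum, h1, h3]
    · simp only [map_sub, map_add, map_smul, map_sum, h2, h4, smul_zero, zero_add, smul_smul]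
      rw [sub_eq_zero]
      conv_lhs => rw [hc]
      refine Finset.sum_congr rfl fun i _ => ?_
      rw [mul_assoc, mul_comm (c i), ← mul_assoc, mul_inv_cancel₀ H.pos, one_mul]

/-- The Hodge star on a cone of a form pulled back from the base. -/
theorem IsConeData.hodgeStar_pullback (H : IsConeData g μ g' μ' f ℓ r e) (h : k + 1 + l = d)
    (h' : k + 1 + (l + 1) = d + 1) (α : T [⋀^Fin (k + 1)]→L[ℝ] V) :
    hodgeStar (fun u v => g' u v) μ' h' (α.compContinuousLinearMap f) =
      ((-1) ^ (k + 1) * r ^ d * (r⁻¹ ^ (k + 1)) ^ 2) •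
        wedgeCovector ℓ ((hodgeStar (fun u v => g u v) μ h α).compContinuousLinearMap f) := by
  obtain ⟨e', horth, hspan, hℓ0, hf0, hℓ, hf⟩ := H.exists_basis
  subst h
  ext v
  rw [hodgeStar_apply_of_orthonormal g' μ' h' _ e' horth hspan, sum_orderEmb_succ
    (fun s => contract h' μ' (e' ∘ s) v • α.compContinuousLinearMap f (e' ∘ s))]
  -- multi-indices containing the radial direction do not contribute
  have hzero : ∀ s : Fin k ↪o Fin (k + 1 + l),
      α.compContinuousLinearMap f (e' ∘ (Fin.cons 0 (Fin.succ ∘ s) : Fin (k + 1) → _)) = 0 := by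
    intro s
    exact α.map_coord_zero (0 : Fin (k + 1)) (by simpa using hf0)
  simp only [hzero, smul_zero, Finset.sum_const_zero, zero_add]
  have hα : ∀ s : Fin (k + 1) ↪o Fin (k + 1 + l),
      α.compContinuousLinearMap f (e' ∘ (Fin.succ ∘ s)) = r⁻¹ ^ (k + 1) • α (e ∘ s) := by
    intro s
    have : (fun i => f ((e' ∘ (Fin.succ ∘ s)) i)) = fun i => r⁻¹ • (e ∘ s) i :=
      funext fun i => hf (s i)
    change α (fun i => f ((e' ∘ (Fin.succ ∘ s)) i)) = _
    rw [this]
    simpa using α.map_smul_univ (fun _ => r⁻¹) (e ∘ s)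
  have hμ : ∀ s : Fin (k + 1) ↪o Fin (k + 1 + l), contract h' μ' (e' ∘ (Fin.succ ∘ s)) v =
      r ^ (k + 1 + l) * ∑ j : Fin (l + 1), (-1) ^ (k + 1 + (j : ℕ)) * (ℓ (v j) *
        (r⁻¹ ^ (k + 1) * contract rfl μ (e ∘ s) (fun i => f (j.removeNth v i)))) := by
    intro s
    rw [H.volume]
    change r ^ (k + 1 + l) * wedgeCovector ℓ (μ.compContinuousLinearMap f)
      (Fin.append (m := k + 1) (n := l + 1) (e' ∘ (Fin.succ ∘ s)) v) = _
    rw [wedgeCovector_apply]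
    congr 1
    refine (Fin.sum_univ_add (a := k + 1) (b := l + 1) _).trans ?_
    rw [Finset.sum_eq_zero, zero_add]
    · refine Finset.sum_congr rfl fun j _ => ?_
      rw [removeNth_natAdd_append]
      simp only [Fin.append_right, Fin.val_natAdd, smul_eq_mul]
      congr 2
      have hap : (fun i => f (Fin.append (e' ∘ (Fin.succ ∘ s)) (j.removeNth v) i)) =
          Fin.append (fun i => r⁻¹ • (e ∘ s) i) (fun i => f (j.removeNth v i)) := by
        funext i
        refine Fin.addCases (fun a => ?_) (fun a => ?_) i
        · simp [hf]
        · simp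
      change μ (fun i => f (Fin.append (e' ∘ (Fin.succ ∘ s)) (j.removeNth v) i)) = _
      rw [hap]
      exact contract_const_smul rfl μ _ _ _
    · intro i _
      simp [hℓ]
  simp only [hα, hμ, ContinuousAlternatingMap.smul_apply, wedgeCovector_apply,
    ContinuousAlternatingMap.compContinuousLinearMap_apply, Finset.smul_sum]
  have hstar : ∀ j : Fin (l + 1), hodgeStar (fun u v => g u v) μ rfl α (⇑f ∘ j.removeNth v) =
      ∑ s : Fin (k + 1) ↪o Fin (k + 1 + l),
        contract rfl μ (e ∘ s) (fun i => f (j.removeNth v i)) • α (e ∘ s) := fun j =>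
    hodgeStar_apply_of_orthonormal g μ rfl α e H.orthonormal H.span _
  simp only [hstar, Finset.mul_sum, Finset.sum_smul, Finset.smul_sum]
  rw [Finset.sum_comm]
  refine Finset.sum_congr rfl fun j _ => Finset.sum_congr rfl fun s _ => ?_
  simp only [smul_smul]
  congr 1
  rw [pow_add (-1 : ℝ) (k + 1) (j : ℕ)]
  ring

/-- The contraction of `ℓ ∧ f^*η` with a vector that is killed by `f` and normalized by `ℓ`. -/
theorem wedgeCovector_pullback_cons (x : T') (hℓ : ℓ x = 1) (hf : f x = 0) (η : T [⋀^Fin k]→L[ℝ] V)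
    (u : Fin k → T') :
    wedgeCovector ℓ (η.compContinuousLinearMap f) (Fin.cons x u : Fin (k + 1) → T') =
      η (fun i => f (u i)) := by
  have hrem : (0 : Fin (k + 1)).removeNth (Fin.cons x u : Fin (k + 1) → T') = u := by
    funext j; simp [Fin.removeNth]
  rw [wedgeCovector_apply, Fin.sum_univ_succ, Finset.sum_eq_zero, add_zero, hrem]
  · simp [hℓ]; rfl
  · intro i _
    obtain ⟨k, rfl⟩ := Nat.exists_eq_succ_of_ne_zero i.pos.ne'
    have : η.compContinuousLinearMap f
        (i.succ.removeNth (Fin.cons x u : Fin (k + 2) → T')) = 0 :=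
      η.map_coord_zero (0 : Fin (k + 1)) (by simpa [Fin.removeNth] using hf)
    rw [this]; simp

/-- The Hodge star on a cone of the wedge product of `dr` with a form pulled back from the base. -/
theorem IsConeData.hodgeStar_wedgeCovector (H : IsConeData g μ g' μ' f ℓ r e) (h : k + l = d)
    (h' : k + 1 + l = d + 1) (β : T [⋀^Fin k]→L[ℝ] V) :
    hodgeStar (fun u v => g' u v) μ' h' (wedgeCovector ℓ (β.compContinuousLinearMap f)) =
      (r ^ d * (r⁻¹ ^ k) ^ 2) •
        (hodgeStar (fun u v => g u v) μ h β).compContinuousLinearMap f := by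
  obtain ⟨e', horth, hspan, hℓ0, hf0, hℓ, hf⟩ := H.exists_basis
  subst h
  ext v
  rw [hodgeStar_apply_of_orthonormal g' μ' h' _ e' horth hspan, sum_orderEmb_succ
    (fun s => contract h' μ' (e' ∘ s) v •
      wedgeCovector ℓ (β.compContinuousLinearMap f) (e' ∘ s))]
  have hzero : ∀ s : Fin (k + 1) ↪o Fin (k + l),
      wedgeCovector ℓ (β.compContinuousLinearMap f) (e' ∘ (Fin.succ ∘ s)) = 0 := by
    intro s
    rw [wedgeCovector_apply]
    exact Finset.sum_eq_zero fun i _ => by simp [hℓ]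
  simp only [hzero, smul_zero, Finset.sum_const_zero, add_zero]
  have hcomp : ∀ s : Fin k ↪o Fin (k + l),
      e' ∘ (Fin.cons 0 (Fin.succ ∘ s) : Fin (k + 1) → Fin (k + l + 1)) =
        Fin.cons (e' 0) (e' ∘ (Fin.succ ∘ s)) := by
    intro s; funext i
    refine Fin.cases ?_ (fun i => ?_) i <;> simp
  have hβ : ∀ s : Fin k ↪o Fin (k + l), wedgeCovector ℓ (β.compContinuousLinearMap f)
      (e' ∘ (Fin.cons 0 (Fin.succ ∘ s) : Fin (k + 1) → Fin (k + l + 1))) =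
        r⁻¹ ^ k • β (e ∘ s) := by
    intro s
    rw [hcomp, wedgeCovector_pullback_cons _ hℓ0 hf0]
    have : (fun i => f ((e' ∘ (Fin.succ ∘ s)) i)) = fun i => r⁻¹ • (e ∘ s) i :=
      funext fun i => hf (s i)
    rw [this]
    simpa using β.map_smul_univ (fun _ => r⁻¹) (e ∘ s)
  have hμ : ∀ s : Fin k ↪o Fin (k + l), contract h' μ'
      (e' ∘ (Fin.cons 0 (Fin.succ ∘ s) : Fin (k + 1) → Fin (k + l + 1))) v =
        r ^ (k + l) * (r⁻¹ ^ k * contract rfl μ (e ∘ s) (fun i => f (v i))) := by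
    intro s
    rw [hcomp, contract_apply, H.volume]
    have hap : (fun j => Fin.append (Fin.cons (e' 0) (e' ∘ (Fin.succ ∘ s)) : Fin (k + 1) → T') v
        (Fin.cast h'.symm j)) =
        (Fin.cons (e' 0) (Fin.append (e' ∘ (Fin.succ ∘ s)) v) : Fin (k + l + 1) → T') := by
      rw [Fin.append_cons]; rfl
    rw [hap, ContinuousAlternatingMap.smul_apply,
      wedgeCovector_pullback_cons _ hℓ0 hf0, smul_eq_mul]
    congr 1
    have hap2 : (fun i => f (Fin.append (e' ∘ (Fin.succ ∘ s)) v i)) =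
        Fin.append (fun i => r⁻¹ • (e ∘ s) i) (fun i => f (v i)) := by
      funext i
      refine Fin.addCases (fun a => ?_) (fun a => ?_) i
      · simp [hf]
      · simp
    rw [hap2]
    exact contract_const_smul rfl μ _ _ _
  simp only [hβ, hμ, ContinuousAlternatingMap.smul_apply,
    ContinuousAlternatingMap.compContinuousLinearMap_apply]
  rw [hodgeStar_apply_of_orthonormal g μ rfl β e H.orthonormal H.span, Finset.smul_sum]
  refine Finset.sum_congr rfl fun s _ => ?_
  simp only [smul_smul]
  congr 1
  change _ = _ * contract rfl μ (e ∘ s) (fun i => f (v i))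
  ring

end Cone

/-! ### Exterior derivatives on a product with a line -/

section ExtDeriv

variable {E V : Type*} [NormedAddCommGroup E] [NormedSpace ℝ E] [NormedAddCommGroup V]
  [NormedSpace ℝ V] {k : ℕ}

open ContinuousAlternatingMap

theorem wedgeCovector_eq_alternatizeUncurryFin (ℓ : E →L[ℝ] ℝ) (φ : E [⋀^Fin k]→L[ℝ] V) :
    wedgeCovector ℓ φ = alternatizeUncurryFin (ℓ.smulRight φ) := by
  ext v
  simp only [wedgeCovector_apply, alternatizeUncurryFin_apply]
  refine Finset.sum_congr rfl fun i _ => ?_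
  simp only [ContinuousLinearMap.smulRight_apply, ContinuousAlternatingMap.smul_apply]
  rcases Nat.even_or_odd (i : ℕ) with h' | h' <;> simp [h'.neg_one_pow]

/-- The wedge product with a fixed covector as a continuous linear map. -/
noncomputable def wedgeCovectorCLM (ℓ : E →L[ℝ] ℝ) :
    (E [⋀^Fin k]→L[ℝ] V) →L[ℝ] (E [⋀^Fin (k + 1)]→L[ℝ] V) :=
  (alternatizeUncurryFinCLM ℝ E V).comp (ContinuousLinearMap.smulRightL ℝ E _ ℓ)

theorem wedgeCovectorCLM_apply (ℓ : E →L[ℝ] ℝ) (φ : E [⋀^Fin k]→L[ℝ] V) :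
    wedgeCovectorCLM ℓ φ = wedgeCovector ℓ φ :=
  (wedgeCovector_eq_alternatizeUncurryFin ℓ φ).symm

/-- The algebra behind `d(ℓ ∧ φ) = -ℓ ∧ dφ` for a constant covector `ℓ`, with `D` in the role of
the derivative of `φ`. -/
theorem alternatizeUncurryFin_wedgeCovectorCLM_comp (ℓ : E →L[ℝ] ℝ)
    (D : E →L[ℝ] E [⋀^Fin k]→L[ℝ] V) :
    alternatizeUncurryFin ((wedgeCovectorCLM ℓ).comp D) =
      -wedgeCovector ℓ (alternatizeUncurryFin D) := by
  -- `(x, y) ↦ ℓ y • D x + ℓ x • D y` is symmetric, so its double alternation vanishes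
  have h := alternatizeUncurryFin_alternatizeUncurryFinCLM_comp_of_symmetric
    (f := (ContinuousLinearMap.smulRightL ℝ E _ ℓ).comp D + ℓ.smulRight D)
    (fun x y => by simp [ContinuousLinearMap.smulRightL, add_comm])
  rw [ContinuousLinearMap.comp_add, alternatizeUncurryFin_add] at h
  have h2 : (alternatizeUncurryFinCLM ℝ E V).comp (ℓ.smulRight D) =
      ℓ.smulRight (alternatizeUncurryFin D) := by
    ext1 x
    simp [alternatizeUncurryFinCLM_apply]
  rw [h2, ← wedgeCovector_eq_alternatizeUncurryFin] at h
  exact eq_neg_of_add_eq_zero_left h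

theorem alternatizeUncurryFin_smulRight_wedgeCovector (ℓ : E →L[ℝ] ℝ) (φ : E [⋀^Fin k]→L[ℝ] V) :
    alternatizeUncurryFin (ℓ.smulRight (wedgeCovector ℓ φ)) = 0 := by
  have h := alternatizeUncurryFin_alternatizeUncurryFinCLM_comp_of_symmetric
    (f := ℓ.smulRight (ℓ.smulRight φ)) (fun x y => by simp [smul_smul, mul_comm])
  rw [← h]
  congr 1
  ext1 x
  simp [alternatizeUncurryFinCLM_apply, wedgeCovector_eq_alternatizeUncurryFin]

theorem extDeriv_of_not_differentiableAt {φ : E → E [⋀^Fin k]→L[ℝ] V} {x : E}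
    (h : ¬ DifferentiableAt ℝ φ x) : extDeriv φ x = 0 := by
  rw [extDeriv, fderiv_zero_of_not_differentiableAt h]
  exact map_zero (alternatizeUncurryFinCLM ℝ E V)

/-- The exterior derivative commutes with the pullback under `E × ℝ → E`. No differentiability is
needed: if `φ` is not differentiable, then neither is its pullback, and both sides are zero. -/
theorem extDeriv_pullback_fst (φ : E → E [⋀^Fin k]→L[ℝ] V) (y : E × ℝ) :
    extDeriv (fun z : E × ℝ => (φ z.1).compContinuousLinearMap (ContinuousLinearMap.fst ℝ E ℝ)) y =
      (extDeriv φ y.1).compContinuousLinearMap (ContinuousLinearMap.fst ℝ E ℝ) := by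
  by_cases h : DifferentiableAt ℝ φ y.1
  · have := extDeriv_pullback (f := (Prod.fst : E × ℝ → E)) (x := y) (r := 2) h contDiffAt_fst
      (by simp)
    simpa only [fderiv_fst] using this
  · rw [extDeriv_of_not_differentiableAt h, extDeriv_of_not_differentiableAt]
    · ext; simp
    · intro hd
      refine h ?_
      have h1 : DifferentiableAt ℝ (fun e : E => (e, y.2)) y.1 := by fun_prop
      have h2 := ((compContinuousLinearMapCLM (F := V) (ι := Fin k)
        (ContinuousLinearMap.inl ℝ E ℝ)).differentiableAt).comp y.1
          (DifferentiableAt.comp y.1 (g := fun z : E × ℝ =>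
            (φ z.1).compContinuousLinearMap (ContinuousLinearMap.fst ℝ E ℝ)) hd h1)
      refine h2.congr_of_eventuallyEq (Filter.Eventually.of_forall fun e => ?_)
      ext v
      rfl

/-- `d(e^{ct} dt ∧ φ) = -e^{ct} dt ∧ dφ` on `E × ℝ`, for a form `φ` pulled back from `E`. As in
`extDeriv_pullback_fst`, no differentiability is needed. -/
theorem extDeriv_exp_smul_wedgeCovector_snd (c : ℝ) (φ : E → E [⋀^Fin k]→L[ℝ] V) (y : E × ℝ) :
    extDeriv (fun z : E × ℝ => Real.exp (c * z.2) • wedgeCovector (ContinuousLinearMap.snd ℝ E ℝ)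
        ((φ z.1).compContinuousLinearMap (ContinuousLinearMap.fst ℝ E ℝ))) y =
      -(Real.exp (c * y.2) • wedgeCovector (ContinuousLinearMap.snd ℝ E ℝ)
        ((extDeriv φ y.1).compContinuousLinearMap (ContinuousLinearMap.fst ℝ E ℝ))) := by
  set dt := ContinuousLinearMap.snd ℝ E ℝ with hdt
  have hexp : HasFDerivAt (fun z : E × ℝ => Real.exp (c * z.2))
      ((Real.exp (c * y.2) * c) • dt) y := by
    have := ((hasFDerivAt_snd (𝕜 := ℝ) (p := y)).const_mul c).exp
    simpa [smul_smul] using this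
  by_cases h : DifferentiableAt ℝ φ y.1
  · have hφ : DifferentiableAt ℝ (fun z : E × ℝ =>
        (φ z.1).compContinuousLinearMap (ContinuousLinearMap.fst ℝ E ℝ)) y :=
      ((compContinuousLinearMapCLM (F := V) (ι := Fin k)
        (ContinuousLinearMap.fst ℝ E ℝ)).differentiableAt).comp y
          (DifferentiableAt.comp y h differentiableAt_fst)
    have hw := ((wedgeCovectorCLM dt).hasFDerivAt (x := (φ y.1).compContinuousLinearMap
      (ContinuousLinearMap.fst ℝ E ℝ))).comp y hφ.hasFDerivAt
    have hprod := hexp.smul hw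
    have hfun : (fun z : E × ℝ => Real.exp (c * z.2) • wedgeCovector dt
        ((φ z.1).compContinuousLinearMap (ContinuousLinearMap.fst ℝ E ℝ))) =
        (fun z : E × ℝ => Real.exp (c * z.2)) • (wedgeCovectorCLM dt ∘ fun z : E × ℝ =>
          (φ z.1).compContinuousLinearMap (ContinuousLinearMap.fst ℝ E ℝ)) := by
      funext z
      simp [wedgeCovectorCLM_apply]
    have hext := extDeriv_pullback_fst φ y
    rw [extDeriv] at hext
    rw [hfun, extDeriv, hprod.fderiv, alternatizeUncurryFin_add, alternatizeUncurryFin_smul,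
      alternatizeUncurryFin_wedgeCovectorCLM_comp, hext]
    have h0 : ((Real.exp (c * y.2) * c) • dt).smulRight ((wedgeCovectorCLM dt ∘ fun z : E × ℝ =>
        (φ z.1).compContinuousLinearMap (ContinuousLinearMap.fst ℝ E ℝ)) y) =
        (Real.exp (c * y.2) * c) • dt.smulRight (wedgeCovector dt
          ((φ y.1).compContinuousLinearMap (ContinuousLinearMap.fst ℝ E ℝ))) := by
      refine ContinuousLinearMap.ext fun x => ?_
      simp [wedgeCovectorCLM_apply, smul_smul]
    rw [h0, alternatizeUncurryFin_smul, alternatizeUncurryFin_smulRight_wedgeCovector, smul_zero,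
      add_zero, smul_neg]
  · rw [extDeriv_of_not_differentiableAt h, extDeriv_of_not_differentiableAt]
    · ext v; simp [wedgeCovector_apply]
    · intro hd
      refine h ?_
      have h1 : DifferentiableAt ℝ (fun e : E => (e, y.2)) y.1 := by fun_prop
      -- contraction with `∂_t` and restriction to `E` recover `φ`
      let K : ((E × ℝ) [⋀^Fin (k + 1)]→L[ℝ] V) →L[ℝ] (E [⋀^Fin k]→L[ℝ] V) :=
        (compContinuousLinearMapCLM (ContinuousLinearMap.inl ℝ E ℝ)).comp
          ((ContinuousLinearMap.apply ℝ _ ((0, 1) : E × ℝ)).comp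
            (curryLeftLI (𝕜 := ℝ) (E := E × ℝ) (F := V) (n := k)).toContinuousLinearMap)
      have h2 := ((K.differentiableAt).comp y.1 (DifferentiableAt.comp y.1 (g := fun z : E × ℝ =>
        Real.exp (c * z.2) • wedgeCovector dt
          ((φ z.1).compContinuousLinearMap (ContinuousLinearMap.fst ℝ E ℝ))) hd h1)).const_smul
            (Real.exp (c * y.2))⁻¹
      refine h2.congr_of_eventuallyEq (Filter.Eventually.of_forall fun e => ?_)
      have hK : K (wedgeCovector dt
          ((φ e).compContinuousLinearMap (ContinuousLinearMap.fst ℝ E ℝ))) = φ e := by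
        ext v
        exact wedgeCovector_pullback_cons ((0, 1) : E × ℝ) (by simp [hdt]) (by simp) (φ e)
          (fun i => (v i, 0))
      change φ e = (Real.exp (c * y.2))⁻¹ • K (Real.exp (c * y.2) • wedgeCovector dt
        ((φ e).compContinuousLinearMap (ContinuousLinearMap.fst ℝ E ℝ)))
      rw [map_smul, hK, smul_smul, inv_mul_cancel₀ (Real.exp_ne_zero _), one_smul]

end ExtDeriv

/-! ### Horizontal lifts in a principal bundle -/

namespace PrincipalBundle

variable
  {EG HG : Type*} [NormedAddCommGroup EG] [NormedSpace ℝ EG] [TopologicalSpace HG]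
  {IG : ModelWithCorners ℝ EG HG} {G : Type*} [TopologicalSpace G] [ChartedSpace HG G] [Group G]
  {EP HP : Type*} [NormedAddCommGroup EP] [NormedSpace ℝ EP] [TopologicalSpace HP]
  {IP : ModelWithCorners ℝ EP HP} {P : Type*} [TopologicalSpace P] [ChartedSpace HP P]
  {EM HM : Type*} [NormedAddCommGroup EM] [NormedSpace ℝ EM] [TopologicalSpace HM]
  {IM : ModelWithCorners ℝ EM HM} {M : Type*} [TopologicalSpace M] [ChartedSpace HM M]
  (B : PrincipalBundle IG G IP P IM M)

theorem mdifferentiableAt_proj (p : P) : MDifferentiableAt IP IM B.proj p :=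
  B.contMDiff_proj.mdifferentiableAt (by simp)

theorem mdifferentiableAt_orbit (p : P) (g : G) :
    MDifferentiableAt IG IP (fun g : G => B.act p g) g := by
  have h : ContMDiff IG IP ∞ (fun g : G => B.act p g) :=
    B.contMDiff_act.comp (contMDiff_const.prodMk contMDiff_id)
  exact h.mdifferentiableAt (by simp)

/-- Fundamental vector fields are vertical. -/
theorem mfderiv_proj_fundamental (p : P) (η : LieAlg IG G) :
    mfderiv IP IM B.proj p (B.fundamental p η) = 0 := by
  have h := mfderiv_comp_apply_of_eq (I := IG) (I' := IP) (I'' := IM)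
    (g := B.proj) (f := fun g : G => B.act p g) (x := (1 : G)) (y := p)
    (B.mdifferentiableAt_proj p) (B.mdifferentiableAt_orbit p 1) (B.act_one p) η
  have hc : B.proj ∘ (fun g : G => B.act p g) = fun _ => B.proj p :=
    funext fun g => B.proj_act p g
  rw [hc, mfderiv_const] at h
  exact h.symm

theorem mfderiv_proj_hor (A : DForm IP P 1 (LieAlg IG G)) (p : P) (X : TangentSpace IP p) :
    mfderiv IP IM B.proj p (B.hor A p X) = mfderiv IP IM B.proj p X := by
  change mfderiv IP IM B.proj p (X - B.fundamental p (conn A p X)) = _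
  rw [map_sub, B.mfderiv_proj_fundamental, sub_zero]

variable {B}

theorem IsConnection.conn_hor {A : DForm IP P 1 (LieAlg IG G)} (hA : B.IsConnection A) (p : P)
    (X : TangentSpace IP p) : conn A p (B.hor A p X) = 0 := by
  change conn A p (X - B.fundamental p (conn A p X)) = 0
  rw [map_sub, hA.fundamental, sub_self]

variable (B)

/-- A principal bundle has a local section through each of its points, so `T_pπ` is onto. -/
theorem exists_rightInverse_mfderiv_proj (p : P) :
    ∃ S : TangentSpace IM (B.proj p) →L[ℝ] TangentSpace IP p,
      (mfderiv IP IM B.proj p).comp S = ContinuousLinearMap.id ℝ _ := by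
  obtain ⟨U, ψ, γ, hU, hx, hψ, -, h1, h2, -⟩ := B.locally_trivial (B.proj p)
  let s : M → P := fun y => ψ (y, γ p)
  have hs : MDifferentiableAt IM IP s (B.proj p) := by
    have hψ' : ContMDiffAt (IM.prod IG) IP ∞ ψ (B.proj p, γ p) :=
      hψ.contMDiffAt ((hU.prod isOpen_univ).mem_nhds ⟨hx, mem_univ _⟩)
    have : ContMDiffAt IM IP ∞ s (B.proj p) :=
      hψ'.comp (B.proj p) (contMDiffAt_id.prodMk contMDiffAt_const)
    exact this.mdifferentiableAt (by simp)
  have hsp : s (B.proj p) = p := h2 p hx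
  refine ⟨mfderiv IM IP s (B.proj p), ?_⟩
  refine ContinuousLinearMap.ext fun v => ?_
  have h := mfderiv_comp_apply_of_eq (I := IM) (I' := IP) (I'' := IM) _
    (B.mdifferentiableAt_proj p) hs hsp v
  have hid : B.proj ∘ s =ᶠ[𝓝 (B.proj p)] id := by
    filter_upwards [hU.mem_nhds hx] with y hy
    exact (h1 y hy _).1
  rw [hid.mfderiv_eq, mfderiv_id] at h
  exact h.symm

/-- Vectors tangent to the fibre are values of fundamental vector fields. -/
theorem exists_fundamental_eq [LieGroup IG ∞ G] (p : P) (X : TangentSpace IP p)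
    (hX : mfderiv IP IM B.proj p X = 0) : ∃ η : LieAlg IG G, B.fundamental p η = X := by
  obtain ⟨U, ψ, γ, hU, hx, hψ, hγ, h1, h2, h3⟩ := B.locally_trivial (B.proj p)
  have hψ' : MDifferentiableAt (IM.prod IG) IP ψ (B.proj p, γ p) :=
    (hψ.contMDiffAt ((hU.prod isOpen_univ).mem_nhds ⟨hx, mem_univ _⟩)).mdifferentiableAt (by simp)
  have hV : B.proj ⁻¹' U ∈ 𝓝 p :=
    (hU.preimage B.contMDiff_proj.continuous).mem_nhds hx
  have hγ' : MDifferentiableAt IP IG γ p := (hγ.contMDiffAt hV).mdifferentiableAt (by simp)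
  -- `p' = ψ (π p', γ p')` near `p`, so `X = dψ (dπ X, dγ X) = dψ (0, dγ X)`
  have e1 : X = mfderiv (IM.prod IG) IP ψ (B.proj p, γ p)
      (mfderiv IP IM B.proj p X, mfderiv IP IG γ p X) := by
    have h := mfderiv_comp_apply (I := IP) (I' := IM.prod IG) (I'' := IP) (x := p)
      (f := fun p' => (B.proj p', γ p')) hψ' ((B.mdifferentiableAt_proj p).prodMk hγ') X
    have hid : ψ ∘ (fun p' => (B.proj p', γ p')) =ᶠ[𝓝 p] id := by
      filter_upwards [hV] with p' hp'
      exact h2 p' hp'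
    rw [hid.mfderiv_eq, mfderiv_id] at h
    have hprod := congrArg (fun L => L X) ((B.mdifferentiableAt_proj p).mfderiv_prod hγ')
    exact h.trans (congrArg _ hprod)
  have e2 : mfderiv IG IP (ψ ∘ fun g => (B.proj p, g)) (γ p) (mfderiv IP IG γ p X) = X := by
    refine (mfderiv_comp_apply (I := IG) (I' := IM.prod IG) (I'' := IP) (γ p)
      hψ' (mdifferentiableAt_const.prodMk mdifferentiableAt_id) _).trans ?_
    refine Eq.trans (congrArg _ ?_) e1.symm
    rw [hX]
    exact congrArg (fun L => L (mfderiv IP IG γ p X))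
      (mfderiv_prod_right (I := IM) (I' := IG) (x₀ := B.proj p) (y₀ := γ p))
  have e3 : (ψ ∘ fun g => (B.proj p, g)) = (fun g => B.act p g) ∘ fun g => (γ p)⁻¹ * g := by
    funext g
    change ψ (B.proj p, g) = B.act p ((γ p)⁻¹ * g)
    rw [← h2 p hx, (h1 _ hx _).1, (h1 _ hx _).2, h3 _ hx, mul_inv_cancel_left]
  have hL : MDifferentiableAt IG IG (fun g : G => (γ p)⁻¹ * g) (γ p) :=
    (contMDiff_mul_left (I := IG) (n := ∞) (a := (γ p)⁻¹)).mdifferentiableAt (by simp)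
  refine ⟨mfderiv IG IG (fun g : G => (γ p)⁻¹ * g) (γ p) (mfderiv IP IG γ p X), ?_⟩
  rw [e3] at e2
  refine Eq.trans ?_ e2
  exact (mfderiv_comp_apply_of_eq (I := IG) (I' := IG) (I'' := IP) _
    (B.mdifferentiableAt_orbit p 1) hL (inv_mul_cancel (γ p)) _).symm

variable {B}

/-- A vector is determined by its projection to the base and its value under a connection. -/
theorem IsConnection.eq_zero [LieGroup IG ∞ G] {A : DForm IP P 1 (LieAlg IG G)}
    (hA : B.IsConnection A) (p : P) (X : TangentSpace IP p)
    (hX : mfderiv IP IM B.proj p X = 0) (hAX : conn A p X = 0) : X = 0 := by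
  obtain ⟨η, rfl⟩ := B.exists_fundamental_eq p X hX
  rw [hA.fundamental] at hAX
  rw [hAX, map_zero]

theorem IsConnection.lift_spec {A : DForm IP P 1 (LieAlg IG G)} (hA : B.IsConnection A) (p : P) :
    (mfderiv IP IM B.proj p).comp (B.lift A p) = ContinuousLinearMap.id ℝ _ ∧
      (conn A p).comp (B.lift A p) = 0 := by
  obtain ⟨S, hS⟩ := B.exists_rightInverse_mfderiv_proj p
  refine Classical.epsilon_spec (p := fun Γ : TangentSpace IM (B.proj p) →L[ℝ] TangentSpace IP p =>
    (mfderiv IP IM B.proj p).comp Γ = ContinuousLinearMap.id ℝ _ ∧ (conn A p).comp Γ = 0)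
    ⟨(B.hor A p).comp S, ?_, ?_⟩
  · refine ContinuousLinearMap.ext fun v => ?_
    exact (B.mfderiv_proj_hor A p (S v)).trans (congrArg (fun L => L v) hS)
  · exact ContinuousLinearMap.ext fun v => hA.conn_hor p (S v)

theorem IsConnection.mfderiv_proj_lift {A : DForm IP P 1 (LieAlg IG G)} (hA : B.IsConnection A)
    (p : P) (v : TangentSpace IM (B.proj p)) : mfderiv IP IM B.proj p (B.lift A p v) = v :=
  congrArg (fun L => L v) (hA.lift_spec p).1

theorem IsConnection.conn_lift {A : DForm IP P 1 (LieAlg IG G)} (hA : B.IsConnection A)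
    (p : P) (v : TangentSpace IM (B.proj p)) : conn A p (B.lift A p v) = 0 :=
  congrArg (fun L => L v) (hA.lift_spec p).2

variable (B)

/-- The operator `∗ D^A ∗` with the degree `l` of the intermediate form `∗φ` as a variable. -/
theorem starDStar_eq {V : Type*} [NormedAddCommGroup V] [NormedSpace ℝ V] {k l m : ℕ}
    (g : ∀ x : M, TangentSpace IM x → TangentSpace IM x → ℝ) (μ : DForm IM M m ℝ)
    (A : DForm IP P 1 (LieAlg IG G)) (h : k + 1 ≤ m) (h₁ : k + 1 + l = m) (h₂ : l + 1 + k = m)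
    (φ : DForm IP P (k + 1) V) :
    B.starDStar g μ A h φ = B.star g μ A h₂ (B.covD A (B.star g μ A h₁ φ)) := by
  obtain rfl : l = m - (k + 1) := by omega
  rfl

end PrincipalBundle

/-! ### Forms on the pullback bundle in charts -/

namespace PrincipalBundle

variable
  {EG HG : Type*} [NormedAddCommGroup EG] [NormedSpace ℝ EG] [TopologicalSpace HG]
  {IG : ModelWithCorners ℝ EG HG} {G : Type*} [TopologicalSpace G] [ChartedSpace HG G] [Group G]
  {EP HP : Type*} [NormedAddCommGroup EP] [NormedSpace ℝ EP] [TopologicalSpace HP]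
  {IP : ModelWithCorners ℝ EP HP} {P : Type*} [TopologicalSpace P] [ChartedSpace HP P]
  {d : ℕ} (B : PrincipalBundle IG G IP P (𝓡 d) (Sph d))
  {V : Type*} [NormedAddCommGroup V] [NormedSpace ℝ V] {k : ℕ}

/-- The function `t = log r` on the total space of the pullback bundle, the second coordinate of
the diffeomorphism with `P × ℝ`. -/
noncomputable def logRadius (q : B.Pullback) : ℝ := Real.log ‖q.base.1‖

theorem contMDiff_logRadius : ContMDiff (IP.prod 𝓘(ℝ, ℝ)) 𝓘(ℝ, ℝ) ∞ B.logRadius :=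
  (contMDiff_snd (I := IP) (J := 𝓘(ℝ, ℝ)) (M := P) (N := ℝ)).comp B.contMDiff_pullbackHomeo

theorem mdifferentiableAt_logRadius (q : B.Pullback) :
    MDifferentiableAt (IP.prod 𝓘(ℝ, ℝ)) 𝓘(ℝ, ℝ) B.logRadius q :=
  B.contMDiff_logRadius.mdifferentiableAt (by simp)

theorem mdifferentiableAt_toP (q : B.Pullback) :
    MDifferentiableAt (IP.prod 𝓘(ℝ, ℝ)) IP (Pullback.toP : B.Pullback → P) q :=
  B.contMDiff_toP.mdifferentiableAt (by simp)

theorem extChartAt_pullback_snd (q q' : B.Pullback) :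
    (extChartAt (IP.prod 𝓘(ℝ, ℝ)) q q').2 = B.logRadius q' := rfl

theorem logRadius_extChartAt_pullback_symm (q : B.Pullback) (z : EP × ℝ) :
    B.logRadius ((extChartAt (IP.prod 𝓘(ℝ, ℝ)) q).symm z) = z.2 :=
  congrArg Prod.snd (B.pullbackHomeo.apply_symm_apply ((extChartAt IP q.toP).symm z.1, z.2))

theorem extChartAt_pullback_target (q : B.Pullback) :
    (extChartAt (IP.prod 𝓘(ℝ, ℝ)) q).target = (extChartAt IP q.toP).target ×ˢ univ := by
  have hc : chartAt (ModelProd HP ℝ) q = B.pullbackHomeo.toOpenPartialHomeomorph.trans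
    (chartAt (ModelProd HP ℝ) (B.pullbackHomeo q)) := rfl
  have h : (extChartAt (IP.prod 𝓘(ℝ, ℝ)) q).target =
      (extChartAt (IP.prod 𝓘(ℝ, ℝ)) (B.pullbackHomeo q)).target := by
    ext z
    simp [extChartAt, hc]
  rw [h, extChartAt_prod, PartialEquiv.prod_target, extChartAt_model_space_eq_id,
    PartialEquiv.refl_target]
  rfl

variable [IsManifold IP ∞ P]

theorem mvfderiv_extChartAt_pullback (q : B.Pullback) (X : TangentSpace (IP.prod 𝓘(ℝ, ℝ)) q) :
    mvfderiv (IP.prod 𝓘(ℝ, ℝ)) (extChartAt (IP.prod 𝓘(ℝ, ℝ)) q) q X =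
      (mvfderiv IP (extChartAt IP q.toP) q.toP
        (mfderiv (IP.prod 𝓘(ℝ, ℝ)) IP (Pullback.toP : B.Pullback → P) q X),
       mvfderiv (IP.prod 𝓘(ℝ, ℝ)) B.logRadius q X) := by
  have hI : IsManifold (IP.prod 𝓘(ℝ, ℝ)) 1 B.Pullback := .of_le (n := ∞) (by simp)
  have hI' : IsManifold IP 1 P := .of_le (n := ∞) (by simp)
  have hq : MDifferentiableAt (IP.prod 𝓘(ℝ, ℝ)) 𝓘(ℝ, EP × ℝ)
      (extChartAt (IP.prod 𝓘(ℝ, ℝ)) q) q := mdifferentiableAt_extChartAt (mem_chart_source _ q)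
  have hp : MDifferentiableAt IP 𝓘(ℝ, EP) (extChartAt IP q.toP) q.toP :=
    mdifferentiableAt_extChartAt (mem_chart_source _ q.toP)
  refine Prod.ext ?_ ?_
  · have h1 := mfderiv_comp_apply (I := IP.prod 𝓘(ℝ, ℝ)) (I' := 𝓘(ℝ, EP × ℝ)) (I'' := 𝓘(ℝ, EP)) q
      (g := (Prod.fst : EP × ℝ → EP)) differentiableAt_fst.mdifferentiableAt hq X
    rw [mfderiv_eq_fderiv, fderiv_fst] at h1
    exact h1.symm.trans (mfderiv_comp_apply q hp (B.mdifferentiableAt_toP q) X)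
  · have h1 := mfderiv_comp_apply (I := IP.prod 𝓘(ℝ, ℝ)) (I' := 𝓘(ℝ, EP × ℝ)) (I'' := 𝓘(ℝ, ℝ)) q
      (g := (Prod.snd : EP × ℝ → ℝ)) differentiableAt_snd.mdifferentiableAt hq X
    rw [mfderiv_eq_fderiv, fderiv_snd] at h1
    exact h1.symm

variable [IP.Boundaryless]

theorem mdifferentiableAt_extChartAt_symm_of_boundaryless {E H X : Type*} [NormedAddCommGroup E]
    [NormedSpace ℝ E] [TopologicalSpace H] {I : ModelWithCorners ℝ E H} [I.Boundaryless]
    [TopologicalSpace X] [ChartedSpace H X] [IsManifold I 1 X] {x : X} {z : E}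
    (hz : z ∈ (extChartAt I x).target) :
    MDifferentiableAt 𝓘(ℝ, E) I (extChartAt I x).symm z := by
  have := mdifferentiableWithinAt_extChartAt_symm (I := I) hz
  rwa [I.range_eq_univ, mdifferentiableWithinAt_univ] at this

theorem mfderiv_toP_extChartAt_symm (q : B.Pullback) (z : EP × ℝ)
    (hz : z ∈ (extChartAt (IP.prod 𝓘(ℝ, ℝ)) q).target) (v : EP × ℝ) :
    mfderiv (IP.prod 𝓘(ℝ, ℝ)) IP (Pullback.toP : B.Pullback → P)
        ((extChartAt (IP.prod 𝓘(ℝ, ℝ)) q).symm z)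
        (mfderiv 𝓘(ℝ, EP × ℝ) (IP.prod 𝓘(ℝ, ℝ)) (extChartAt (IP.prod 𝓘(ℝ, ℝ)) q).symm z v) =
      mfderiv 𝓘(ℝ, EP) IP (extChartAt IP q.toP).symm z.1 v.1 := by
  have hz1 : z.1 ∈ (extChartAt IP q.toP).target := by
    rw [extChartAt_pullback_target] at hz
    exact hz.1
  have hI : IsManifold (IP.prod 𝓘(ℝ, ℝ)) 1 B.Pullback := .of_le (n := ∞) (by simp)
  have hI' : IsManifold IP 1 P := .of_le (n := ∞) (by simp)
  have h1 := mfderiv_comp_apply z (B.mdifferentiableAt_toP _)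
    (mdifferentiableAt_extChartAt_symm_of_boundaryless hz) v
  have hfst : MDifferentiableAt 𝓘(ℝ, EP × ℝ) 𝓘(ℝ, EP) (Prod.fst : EP × ℝ → EP) z :=
    differentiableAt_fst.mdifferentiableAt
  have h2 := mfderiv_comp_apply (I := 𝓘(ℝ, EP × ℝ)) (I' := 𝓘(ℝ, EP)) (I'' := IP) z
    (f := (Prod.fst : EP × ℝ → EP)) (mdifferentiableAt_extChartAt_symm_of_boundaryless hz1) hfst v
  have h3 : mfderiv 𝓘(ℝ, EP × ℝ) 𝓘(ℝ, EP) (Prod.fst : EP × ℝ → EP) z =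
      ContinuousLinearMap.fst ℝ EP ℝ := by
    rw [mfderiv_eq_fderiv, fderiv_fst]
  rw [h3] at h2
  exact h1.symm.trans h2

theorem mvfderiv_logRadius_extChartAt_symm (q : B.Pullback) (z : EP × ℝ)
    (hz : z ∈ (extChartAt (IP.prod 𝓘(ℝ, ℝ)) q).target) (v : EP × ℝ) :
    mvfderiv (IP.prod 𝓘(ℝ, ℝ)) B.logRadius ((extChartAt (IP.prod 𝓘(ℝ, ℝ)) q).symm z)
        (mfderiv 𝓘(ℝ, EP × ℝ) (IP.prod 𝓘(ℝ, ℝ)) (extChartAt (IP.prod 𝓘(ℝ, ℝ)) q).symm z v) =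
      v.2 := by
  have hI : IsManifold (IP.prod 𝓘(ℝ, ℝ)) 1 B.Pullback := .of_le (n := ∞) (by simp)
  have h1 := mfderiv_comp_apply z (B.mdifferentiableAt_logRadius _)
    (mdifferentiableAt_extChartAt_symm_of_boundaryless hz) v
  have hfun : B.logRadius ∘ (extChartAt (IP.prod 𝓘(ℝ, ℝ)) q).symm = Prod.snd :=
    funext fun z => B.logRadius_extChartAt_pullback_symm q z
  rw [hfun, mfderiv_eq_fderiv, fderiv_snd] at h1
  exact h1.symm

theorem inChart_pullbackForm (φ : DForm IP P k V) (q : B.Pullback) (z : EP × ℝ)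
    (hz : z ∈ (extChartAt (IP.prod 𝓘(ℝ, ℝ)) q).target) :
    (B.pullbackForm φ).inChart q z =
      (φ.inChart q.toP z.1).compContinuousLinearMap (ContinuousLinearMap.fst ℝ EP ℝ) := by
  ext v
  exact congrArg (φ ((extChartAt IP q.toP).symm z.1))
    (funext fun i => B.mfderiv_toP_extChartAt_symm q z hz (v i))

/-- `d F^* φ = F^* dφ`. In charts adapted to `f^*P ≅ P × ℝ`, the map `F` is the projection
`(e, t) ↦ e`. -/
theorem extd_pullbackForm (φ : DForm IP P k V) :
    (B.pullbackForm φ).extd = B.pullbackForm φ.extd := by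
  funext q
  have h : (B.pullbackForm φ).inChart q =ᶠ[𝓝 (extChartAt (IP.prod 𝓘(ℝ, ℝ)) q q)]
      fun z => (φ.inChart q.toP z.1).compContinuousLinearMap (ContinuousLinearMap.fst ℝ EP ℝ) := by
    filter_upwards [extChartAt_target_mem_nhds (I := IP.prod 𝓘(ℝ, ℝ)) q] with z hz
    exact B.inChart_pullbackForm φ q z hz
  have h2 := h.extDeriv_eq.trans (extDeriv_pullback_fst _ _)
  ext v
  refine (congrArg (fun η => η fun i =>
    mvfderiv (IP.prod 𝓘(ℝ, ℝ)) (extChartAt (IP.prod 𝓘(ℝ, ℝ)) q) q (v i)) h2).trans ?_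
  refine congrArg (extDeriv (φ.inChart q.toP) (extChartAt IP q.toP q.toP)) (funext fun i => ?_)
  exact congrArg Prod.fst (B.mvfderiv_extChartAt_pullback q (v i))

/-- The form `e^{ct} dt ∧ F^* φ` on the pullback bundle, where `t = log r`. -/
noncomputable def expWedge (c : ℝ) (φ : DForm IP P k V) :
    DForm (IP.prod 𝓘(ℝ, ℝ)) B.Pullback (k + 1) V :=
  fun q => Real.exp (c * B.logRadius q) •
    wedgeCovector (mvfderiv (IP.prod 𝓘(ℝ, ℝ)) B.logRadius q) (B.pullbackForm φ q)

theorem inChart_expWedge (c : ℝ) (φ : DForm IP P k V) (q : B.Pullback) (z : EP × ℝ)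
    (hz : z ∈ (extChartAt (IP.prod 𝓘(ℝ, ℝ)) q).target) :
    (B.expWedge c φ).inChart q z = Real.exp (c * z.2) •
      wedgeCovector (ContinuousLinearMap.snd ℝ EP ℝ)
        ((φ.inChart q.toP z.1).compContinuousLinearMap (ContinuousLinearMap.fst ℝ EP ℝ)) := by
  rw [← B.inChart_pullbackForm φ q z hz]
  ext v
  refine Eq.trans (b := Real.exp (c * B.logRadius ((extChartAt (IP.prod 𝓘(ℝ, ℝ)) q).symm z)) •
    wedgeCovector (mvfderiv (IP.prod 𝓘(ℝ, ℝ)) B.logRadius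
      ((extChartAt (IP.prod 𝓘(ℝ, ℝ)) q).symm z))
      (B.pullbackForm φ ((extChartAt (IP.prod 𝓘(ℝ, ℝ)) q).symm z)) fun i =>
        mfderiv 𝓘(ℝ, EP × ℝ) (IP.prod 𝓘(ℝ, ℝ)) (extChartAt (IP.prod 𝓘(ℝ, ℝ)) q).symm z (v i))
    rfl ?_
  rw [ContinuousAlternatingMap.smul_apply, logRadius_extChartAt_pullback_symm,
    wedgeCovector_apply, wedgeCovector_apply]
  refine congrArg _ (Finset.sum_congr rfl fun i _ => ?_)
  rw [B.mvfderiv_logRadius_extChartAt_symm q z hz]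
  rfl

/-- `d (e^{ct} dt ∧ F^* φ) = -e^{ct} dt ∧ F^* dφ`. -/
theorem extd_expWedge (c : ℝ) (φ : DForm IP P k V) :
    (B.expWedge c φ).extd = fun q => -(B.expWedge c φ.extd q) := by
  funext q
  have h : (B.expWedge c φ).inChart q =ᶠ[𝓝 (extChartAt (IP.prod 𝓘(ℝ, ℝ)) q q)]
      fun z => Real.exp (c * z.2) • wedgeCovector (ContinuousLinearMap.snd ℝ EP ℝ)
        ((φ.inChart q.toP z.1).compContinuousLinearMap (ContinuousLinearMap.fst ℝ EP ℝ)) := by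
    filter_upwards [extChartAt_target_mem_nhds (I := IP.prod 𝓘(ℝ, ℝ)) q] with z hz
    exact B.inChart_expWedge c φ q z hz
  have h2 := h.extDeriv_eq.trans (extDeriv_exp_smul_wedgeCovector_snd c _ _)
  ext v
  refine (congrArg (fun η => η fun i =>
    mvfderiv (IP.prod 𝓘(ℝ, ℝ)) (extChartAt (IP.prod 𝓘(ℝ, ℝ)) q) q (v i)) h2).trans ?_
  rw [expWedge, ContinuousAlternatingMap.neg_apply, ContinuousAlternatingMap.neg_apply,
    ContinuousAlternatingMap.smul_apply, ContinuousAlternatingMap.smul_apply,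
    wedgeCovector_apply, wedgeCovector_apply, extChartAt_pullback_snd]
  refine congrArg (fun x => -(Real.exp (c * B.logRadius q) • x))
    (Finset.sum_congr rfl fun i _ => ?_)
  rw [B.mvfderiv_extChartAt_pullback q (v i)]
  refine congrArg (fun x => (-1 : ℝ) ^ (i : ℕ) •
    mvfderiv (IP.prod 𝓘(ℝ, ℝ)) B.logRadius q (v i) • x) ?_
  refine congrArg (extDeriv (φ.inChart q.toP) (extChartAt IP q.toP q.toP)) (funext fun j => ?_)
  exact congrArg Prod.fst (B.mvfderiv_extChartAt_pullback q (i.removeNth v j))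

end PrincipalBundle

/-! ### The pulled back connection -/

namespace PrincipalBundle

variable
  {EG HG : Type*} [NormedAddCommGroup EG] [NormedSpace ℝ EG] [TopologicalSpace HG]
  {IG : ModelWithCorners ℝ EG HG} {G : Type*} [TopologicalSpace G] [ChartedSpace HG G] [Group G]
  {EP HP : Type*} [NormedAddCommGroup EP] [NormedSpace ℝ EP] [TopologicalSpace HP]
  {IP : ModelWithCorners ℝ EP HP} {P : Type*} [TopologicalSpace P] [ChartedSpace HP P]
  {d : ℕ} (B : PrincipalBundle IG G IP P (𝓡 d) (Sph d))
  {V : Type*} [NormedAddCommGroup V] [NormedSpace ℝ V] {k : ℕ}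

theorem conn_pullbackForm (A : DForm IP P 1 (LieAlg IG G)) (q : B.Pullback)
    (X : TangentSpace (IP.prod 𝓘(ℝ, ℝ)) q) :
    conn (B.pullbackForm A) q X = conn A q.toP
      (mfderiv (IP.prod 𝓘(ℝ, ℝ)) IP (Pullback.toP : B.Pullback → P) q X) := rfl

/-- The bundle homomorphism maps fundamental vector fields to fundamental vector fields. -/
theorem mfderiv_toP_fundamental (q : B.Pullback) (η : LieAlg IG G) :
    mfderiv (IP.prod 𝓘(ℝ, ℝ)) IP (Pullback.toP : B.Pullback → P) q
      (B.pullbackBundle.fundamental q η) = B.fundamental q.toP η :=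
  (mfderiv_comp_apply_of_eq (I := IG) (I' := IP.prod 𝓘(ℝ, ℝ)) (I'' := IP) _
    (B.mdifferentiableAt_toP q) (B.pullbackBundle.mdifferentiableAt_orbit q 1)
    (B.pullbackBundle.act_one q) η).symm

theorem mvfderiv_logRadius_fundamental (q : B.Pullback) (η : LieAlg IG G) :
    mvfderiv (IP.prod 𝓘(ℝ, ℝ)) B.logRadius q (B.pullbackBundle.fundamental q η) = 0 := by
  have h := mfderiv_comp_apply_of_eq (I := IG) (I' := IP.prod 𝓘(ℝ, ℝ)) (I'' := 𝓘(ℝ, ℝ)) _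
    (B.mdifferentiableAt_logRadius q) (B.pullbackBundle.mdifferentiableAt_orbit q 1)
    (B.pullbackBundle.act_one q) η
  have hc : B.logRadius ∘ (fun g : G => B.pullbackBundle.act q g) = fun _ => B.logRadius q := rfl
  rw [hc, mfderiv_const] at h
  exact h.symm

theorem mfderiv_toP_hor (A : DForm IP P 1 (LieAlg IG G)) (q : B.Pullback)
    (X : TangentSpace (IP.prod 𝓘(ℝ, ℝ)) q) :
    mfderiv (IP.prod 𝓘(ℝ, ℝ)) IP (Pullback.toP : B.Pullback → P) q
        (B.pullbackBundle.hor (B.pullbackForm A) q X) =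
      B.hor A q.toP (mfderiv (IP.prod 𝓘(ℝ, ℝ)) IP (Pullback.toP : B.Pullback → P) q X) := by
  change mfderiv (IP.prod 𝓘(ℝ, ℝ)) IP (Pullback.toP : B.Pullback → P) q
    (X - B.pullbackBundle.fundamental q (conn (B.pullbackForm A) q X)) = _
  rw [map_sub, mfderiv_toP_fundamental]
  rfl

theorem mvfderiv_logRadius_hor (A : DForm IP P 1 (LieAlg IG G)) (q : B.Pullback)
    (X : TangentSpace (IP.prod 𝓘(ℝ, ℝ)) q) :
    mvfderiv (IP.prod 𝓘(ℝ, ℝ)) B.logRadius q (B.pullbackBundle.hor (B.pullbackForm A) q X) =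
      mvfderiv (IP.prod 𝓘(ℝ, ℝ)) B.logRadius q X := by
  change mvfderiv (IP.prod 𝓘(ℝ, ℝ)) B.logRadius q
    (X - B.pullbackBundle.fundamental q (conn (B.pullbackForm A) q X)) = _
  rw [map_sub, mvfderiv_logRadius_fundamental, sub_zero]

section Derivatives

variable [IsManifold IP ∞ P] [IP.Boundaryless]

/-- The covariant derivative commutes with the pullback under the bundle homomorphism. -/
theorem covD_pullbackForm (A : DForm IP P 1 (LieAlg IG G)) (φ : DForm IP P k V) :
    B.pullbackBundle.covD (B.pullbackForm A) (B.pullbackForm φ) =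
      B.pullbackForm (B.covD A φ) := by
  funext q
  rw [covD, extd_pullbackForm]
  ext v
  exact congrArg (φ.extd q.toP) (funext fun i => B.mfderiv_toP_hor A q (v i))

theorem curvature_pullbackForm (A : DForm IP P 1 (LieAlg IG G)) :
    B.pullbackBundle.curvature (B.pullbackForm A) = B.pullbackForm (B.curvature A) :=
  B.covD_pullbackForm A A

theorem covD_expWedge (A : DForm IP P 1 (LieAlg IG G)) (c : ℝ) (φ : DForm IP P k V) :
    B.pullbackBundle.covD (B.pullbackForm A) (B.expWedge c φ) =
      fun q => -(B.expWedge c (B.covD A φ) q) := by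
  funext q
  rw [covD, extd_expWedge]
  ext v
  change -((B.expWedge c φ.extd q) fun i => B.pullbackBundle.hor (B.pullbackForm A) q (v i)) =
    -(B.expWedge c (B.covD A φ) q v)
  rw [expWedge, expWedge, ContinuousAlternatingMap.smul_apply,
    ContinuousAlternatingMap.smul_apply, wedgeCovector_apply, wedgeCovector_apply]
  refine congrArg (fun x => -(Real.exp (c * B.logRadius q) • x))
    (Finset.sum_congr rfl fun i _ => ?_)
  rw [mvfderiv_logRadius_hor]
  refine congrArg (fun x => (-1 : ℝ) ^ (i : ℕ) •
    mvfderiv (IP.prod 𝓘(ℝ, ℝ)) B.logRadius q (v i) • x) ?_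
  exact congrArg (φ.extd q.toP) (funext fun j => B.mfderiv_toP_hor A q (i.removeNth v j))

theorem isSmooth_pullbackForm {φ : DForm IP P k V} (hφ : φ.IsSmooth) :
    (B.pullbackForm φ).IsSmooth := by
  intro q
  have h1 : ContDiffOn ℝ ∞ (fun z : EP × ℝ => φ.inChart q.toP z.1)
      (extChartAt (IP.prod 𝓘(ℝ, ℝ)) q).target := by
    refine (hφ q.toP).comp contDiff_fst.contDiffOn fun z hz => ?_
    rw [extChartAt_pullback_target] at hz
    exact hz.1
  have h2 := (ContinuousAlternatingMap.compContinuousLinearMapCLM (F := V) (ι := Fin k)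
    (ContinuousLinearMap.fst ℝ EP ℝ)).contDiff.comp_contDiffOn h1
  exact h2.congr fun z hz => B.inChart_pullbackForm φ q z hz

theorem isConnection_pullbackForm {A : DForm IP P 1 (LieAlg IG G)} (hA : B.IsConnection A) :
    B.pullbackBundle.IsConnection (B.pullbackForm A) where
  smooth := B.isSmooth_pullbackForm hA.smooth
  equivariant g := by
    funext q
    have hact : MDifferentiableAt (IP.prod 𝓘(ℝ, ℝ)) (IP.prod 𝓘(ℝ, ℝ))
        (fun q => B.pullbackBundle.act q g) q := by
      have : ContMDiff (IP.prod 𝓘(ℝ, ℝ)) (IP.prod 𝓘(ℝ, ℝ)) ∞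
          (fun q => B.pullbackBundle.act q g) :=
        B.pullbackBundle.contMDiff_act.comp (contMDiff_id.prodMk contMDiff_const)
      exact this.mdifferentiableAt (by simp)
    have hact' : MDifferentiableAt IP IP (fun p => B.act p g) q.toP := by
      have : ContMDiff IP IP ∞ (fun p => B.act p g) :=
        B.contMDiff_act.comp (contMDiff_id.prodMk contMDiff_const)
      exact this.mdifferentiableAt (by simp)
    ext v
    have h := congrArg (fun η : DForm IP P 1 (LieAlg IG G) => η q.toP fun i =>
      mfderiv (IP.prod 𝓘(ℝ, ℝ)) IP (Pullback.toP : B.Pullback → P) q (v i)) (hA.equivariant g)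
    refine Eq.trans ?_ h
    refine congrArg (A (B.act q.toP g)) (funext fun i => ?_)
    have e1 := mfderiv_comp_apply (I'' := IP) q (g := (Pullback.toP : B.Pullback → P))
      (B.mdifferentiableAt_toP _) hact (v i)
    have e2 := mfderiv_comp_apply q hact' (B.mdifferentiableAt_toP q) (v i)
    exact e1.symm.trans e2
  fundamental q η := by
    rw [conn_pullbackForm, mfderiv_toP_fundamental]
    exact hA.fundamental _ _

end Derivatives

/-- The derivative of the radial projection `f` at `π̄(q)`, with `f(π̄(q)) = π(F(q))` as the foot
point of its values. -/
noncomputable def radialDeriv (q : B.Pullback) :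
    TangentSpace (𝓡 (d + 1)) (B.pullbackBundle.proj q) →L[ℝ] TangentSpace (𝓡 d) (B.proj q.toP) :=
  show EuclideanSpace ℝ (Fin (d + 1)) →L[ℝ] EuclideanSpace ℝ (Fin d) from
    mfderiv (𝓡 (d + 1)) (𝓡 d) (radial d) q.base

/-- The derivative of `π ∘ F = f ∘ π̄`. -/
theorem mfderiv_proj_toP (q : B.Pullback) (X : TangentSpace (IP.prod 𝓘(ℝ, ℝ)) q) :
    mfderiv IP (𝓡 d) B.proj q.toP
        (mfderiv (IP.prod 𝓘(ℝ, ℝ)) IP (Pullback.toP : B.Pullback → P) q X) =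
      B.radialDeriv q
        (mfderiv (IP.prod 𝓘(ℝ, ℝ)) (𝓡 (d + 1)) B.pullbackBundle.proj q X) := by
  have h1 := mfderiv_comp_apply q (B.mdifferentiableAt_proj q.toP) (B.mdifferentiableAt_toP q) X
  have h2 := mfderiv_comp_apply q
    ((contMDiff_radial d).mdifferentiableAt (x := B.pullbackBundle.proj q) (by simp))
    (B.pullbackBundle.mdifferentiableAt_proj q) X
  have hfun : B.proj ∘ (Pullback.toP : B.Pullback → P) = radial d ∘ B.pullbackBundle.proj :=
    funext fun q => q.proj_eq
  rw [hfun] at h1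
  exact h1.symm.trans h2

/-- The bundle homomorphism maps horizontal lifts to horizontal lifts. -/
theorem mfderiv_toP_lift [LieGroup IG ∞ G] {A : DForm IP P 1 (LieAlg IG G)}
    (hA : B.IsConnection A) (hA' : B.pullbackBundle.IsConnection (B.pullbackForm A))
    (q : B.Pullback) (v : TangentSpace (𝓡 (d + 1)) (B.pullbackBundle.proj q)) :
    mfderiv (IP.prod 𝓘(ℝ, ℝ)) IP (Pullback.toP : B.Pullback → P) q
        (B.pullbackBundle.lift (B.pullbackForm A) q v) = B.lift A q.toP (B.radialDeriv q v) := by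
  refine sub_eq_zero.1 (hA.eq_zero q.toP _ ?_ ?_)
  · rw [map_sub, hA.mfderiv_proj_lift, mfderiv_proj_toP, hA'.mfderiv_proj_lift, sub_self]
  · rw [map_sub, hA.conn_lift, sub_zero]
    exact hA'.conn_lift q v

end PrincipalBundle

/-! ### Punctured space as a cone over the sphere -/

section Sphere

variable {d : ℕ}

theorem mdifferentiableAt_coe_punctured (x : Punctured d) : MDifferentiableAt (𝓡 d)
    𝓘(ℝ, EuclideanSpace ℝ (Fin d)) (Subtype.val : Punctured d → EuclideanSpace ℝ (Fin d)) x :=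
  ContMDiff.mdifferentiableAt (n := ∞) contMDiff_subtype_val (by simp)

theorem mdifferentiableAt_coe_sph (y : Sph d) : MDifferentiableAt (𝓡 d)
    𝓘(ℝ, EuclideanSpace ℝ (Fin (d + 1)))
    (Subtype.val : Sph d → EuclideanSpace ℝ (Fin (d + 1))) y := by
  have := Fact.mk (@finrank_euclideanSpace_fin ℝ _ (d + 1))
  exact ContMDiff.mdifferentiableAt (n := ∞) contMDiff_coe_sphere (by simp)

/-- In the chart of an open subset of a vector space, the derivative of the inclusion is the
identity. -/
theorem mvfderiv_coe_punctured (x : Punctured d) (v : EuclideanSpace ℝ (Fin d)) :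
    mvfderiv (𝓡 d) (Subtype.val : Punctured d → EuclideanSpace ℝ (Fin d)) x v = v := by
  rw [(mdifferentiableAt_coe_punctured x).mvfderiv]
  have h := TopologicalSpace.Opens.chartAt_subtype_val_symm_eventuallyEq
    (H := EuclideanSpace ℝ (Fin d)) (Punctured d) (x := x)
  have h2 : writtenInExtChartAt (𝓡 d) 𝓘(ℝ, EuclideanSpace ℝ (Fin d)) x
      (Subtype.val : Punctured d → EuclideanSpace ℝ (Fin d)) =ᶠ[𝓝 (extChartAt (𝓡 d) x x)] id := by
    filter_upwards [h] with z hz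
    exact hz.symm
  rw [ModelWithCorners.range_eq_univ, fderivWithin_univ, h2.fderiv_eq, fderiv_id]
  rfl

theorem hasFDerivAt_norm_euclidean {E : Type*} [NormedAddCommGroup E] [InnerProductSpace ℝ E]
    {x : E} (hx : x ≠ 0) : HasFDerivAt (fun z : E => ‖z‖) (‖x‖⁻¹ • innerSL ℝ x) x := by
  have h := ((hasStrictFDerivAt_norm_sq x).hasFDerivAt).sqrt (by simpa using hx)
  simp only [Real.sqrt_sq (norm_nonneg _)] at h
  convert h using 1
  rw [← Nat.cast_smul_eq_nsmul ℝ, smul_smul]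
  congr 1
  push_cast
  field_simp

/-- The derivative of the radial projection `x ↦ x / ‖x‖`. -/
theorem mvfderiv_coe_mfderiv_radial (x : Punctured (d + 1)) (y : Sph d) (hy : y = radial d x)
    (D : TangentSpace (𝓡 (d + 1)) x →L[ℝ] TangentSpace (𝓡 d) y)
    (hD : D = (show EuclideanSpace ℝ (Fin (d + 1)) →L[ℝ] EuclideanSpace ℝ (Fin d) from
      mfderiv (𝓡 (d + 1)) (𝓡 d) (radial d) x))
    (v : TangentSpace (𝓡 (d + 1)) x) :
    mvfderiv (𝓡 d) (Subtype.val : Sph d → EuclideanSpace ℝ (Fin (d + 1))) y (D v) =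
      ‖x.1‖⁻¹ • (mvfderiv (𝓡 (d + 1))
          (Subtype.val : Punctured (d + 1) → EuclideanSpace ℝ (Fin (d + 1))) x v -
        ⟪y.1, mvfderiv (𝓡 (d + 1))
          (Subtype.val : Punctured (d + 1) → EuclideanSpace ℝ (Fin (d + 1))) x v⟫ • y.1) := by
  subst hy hD
  have h1 := mfderiv_comp_apply x (mdifferentiableAt_coe_sph (radial d x))
    ((contMDiff_radial d).mdifferentiableAt (x := x) (by simp)) v
  have hx : x.1 ≠ 0 := x.2
  have hr : ‖x.1‖ ≠ 0 := norm_ne_zero_iff.2 hx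
  have hN : HasFDerivAt (fun z : EuclideanSpace ℝ (Fin (d + 1)) => ‖z‖⁻¹ • z) _ x.1 :=
    ((hasDerivAt_inv hr).comp_hasFDerivAt x.1 (hasFDerivAt_norm_euclidean hx)).smul (hasFDerivAt_id x.1)
  have h2 := mfderiv_comp_apply x (hN.differentiableAt.mdifferentiableAt)
    (mdifferentiableAt_coe_punctured x) v
  rw [mfderiv_eq_fderiv, hN.fderiv] at h2
  refine h1.symm.trans (Eq.trans h2 ?_)
  set w := mvfderiv (𝓡 (d + 1))
    (Subtype.val : Punctured (d + 1) → EuclideanSpace ℝ (Fin (d + 1))) x v with hw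
  have hy : (radial d x).1 = ‖x.1‖⁻¹ • x.1 := rfl
  rw [hy, inner_smul_left]
  simp only [smul_sub, smul_smul]
  change ‖x.1‖⁻¹ • w + (-(‖x.1‖ ^ 2)⁻¹ * ‖x.1‖⁻¹ * ⟪x.1, w⟫) • x.1 = _
  rw [sub_eq_add_neg, ← neg_smul]
  congr 2
  simp
  ring

theorem mvfderiv_coe_sph_injective (y : Sph d) : Function.Injective
    (mvfderiv (𝓡 d) (Subtype.val : Sph d → EuclideanSpace ℝ (Fin (d + 1))) y) := by
  have := Fact.mk (@finrank_euclideanSpace_fin ℝ _ (d + 1))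
  exact injective_mvfderiv_subtypeVal_sphere y

theorem inner_mvfderiv_coe_sph (y : Sph d) (u : TangentSpace (𝓡 d) y) :
    ⟪y.1, mvfderiv (𝓡 d) (Subtype.val : Sph d → EuclideanSpace ℝ (Fin (d + 1))) y u⟫ = 0 := by
  have := Fact.mk (@finrank_euclideanSpace_fin ℝ _ (d + 1))
  have h : mvfderiv (𝓡 d) (Subtype.val : Sph d → EuclideanSpace ℝ (Fin (d + 1))) y u ∈
      (Submodule.span ℝ {(y : EuclideanSpace ℝ (Fin (d + 1)))})ᗮ := by
    rw [← range_mvfderiv_subtypeVal (n := d) y]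
    exact ⟨u, rfl⟩
  exact Submodule.mem_orthogonal_singleton_iff_inner_right.1 h

/-- The round metric at a point as a bilinear form. -/
noncomputable def sphBilin (y : Sph d) : LinearMap.BilinForm ℝ (TangentSpace (𝓡 d) y) :=
  (innerₗ (EuclideanSpace ℝ (Fin (d + 1)))).compl₁₂
    (mvfderiv (𝓡 d) (Subtype.val : Sph d → EuclideanSpace ℝ (Fin (d + 1))) y).toLinearMap
    (mvfderiv (𝓡 d) (Subtype.val : Sph d → EuclideanSpace ℝ (Fin (d + 1))) y).toLinearMap

/-- The Euclidean metric at a point of punctured space as a bilinear form. -/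
noncomputable def puncBilin (x : Punctured d) : LinearMap.BilinForm ℝ (TangentSpace (𝓡 d) x) :=
  (innerₗ (EuclideanSpace ℝ (Fin d))).compl₁₂
    (mvfderiv (𝓡 d) (Subtype.val : Punctured d → EuclideanSpace ℝ (Fin d)) x).toLinearMap
    (mvfderiv (𝓡 d) (Subtype.val : Punctured d → EuclideanSpace ℝ (Fin d)) x).toLinearMap

/-- The covector `dr` at the point `x = r y` of punctured space. -/
noncomputable def radialCovector (x : Punctured (d + 1)) (y : Sph d) :
    TangentSpace (𝓡 (d + 1)) x →L[ℝ] ℝ :=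
  (innerSL ℝ y.1).comp (mvfderiv (𝓡 (d + 1))
    (Subtype.val : Punctured (d + 1) → EuclideanSpace ℝ (Fin (d + 1))) x)

/-- An orthonormal basis of the range of the derivative of the inclusion of the sphere, pulled back
along this injective derivative. -/
theorem exists_orthonormal_sph (y : Sph d) : ∃ e : Fin d → TangentSpace (𝓡 d) y,
    (∀ i j, sphBilin y (e i) (e j) = if i = j then 1 else 0) ∧
      ∀ x, ∃ c : Fin d → ℝ, x = ∑ a, c a • e a := by
  let J : EuclideanSpace ℝ (Fin d) →ₗ[ℝ] EuclideanSpace ℝ (Fin (d + 1)) :=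
    (mvfderiv (𝓡 d) (Subtype.val : Sph d → EuclideanSpace ℝ (Fin (d + 1))) y).toLinearMap
  have hJ : Function.Injective J := mvfderiv_coe_sph_injective y
  have hr : Module.finrank ℝ (LinearMap.range J) = d := by
    rw [LinearMap.finrank_range_of_inj hJ, finrank_euclideanSpace_fin]
  let b := (stdOrthonormalBasis ℝ (LinearMap.range J)).reindex (finCongr hr)
  choose e he using fun i => (b i).2
  refine ⟨e, fun i j => ?_, fun x => ⟨fun i => b.repr ⟨J x, x, rfl⟩ i, ?_⟩⟩
  · have h := orthonormal_iff_ite.1 b.orthonormal i j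
    rw [Submodule.coe_inner, ← he i, ← he j] at h
    exact h
  · refine hJ ?_
    have h := congrArg Subtype.val (b.sum_repr ⟨J x, x, rfl⟩)
    rw [AddSubmonoidClass.coe_finsetSum] at h
    refine h.symm.trans ?_
    refine Eq.trans ?_ (map_sum J _ _).symm
    refine Finset.sum_congr rfl fun i _ => ?_
    rw [Submodule.coe_smul, ← he i]
    exact (map_smul J _ _).symm

/-- Components along `y` do not contribute to `det (y, ·, …, ·)`. -/
theorem curryLeft_sub_smul {E F : Type*} [NormedAddCommGroup E] [NormedSpace ℝ E]
    [NormedAddCommGroup F] [NormedSpace ℝ F] (μ : E [⋀^Fin (d + 1)]→L[ℝ] F) (y : E)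
    (w : Fin d → E) (c : Fin d → ℝ) :
    μ.curryLeft y (fun i => w i - c i • y) = μ.curryLeft y w := by
  have h0 : ∀ (v : Fin d → E) (i : Fin d) (a : ℝ), v i = a • y → μ.curryLeft y v = 0 := by
    intro v i a hv
    have hup : v = Function.update v i (a • y) := by rw [← hv, Function.update_eq_self]
    rw [hup, (μ.curryLeft y).map_update_smul]
    have : μ (Matrix.vecCons y (Function.update v i y)) = 0 :=
      μ.map_eq_zero_of_eq _ (i := 0) (j := i.succ) (by simp) (Fin.succ_ne_zero i).symm
    exact (congrArg (a • ·) this).trans (smul_zero a)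
  have hadd := (μ.curryLeft y).map_add_univ w (fun i => -(c i) • y)
  have hw : (fun i => w i - c i • y) = w + fun i => -(c i) • y := by
    funext i; simp [sub_eq_add_neg]
  rw [hw, hadd, Finset.sum_eq_single Finset.univ]
  · simp
  · intro s _ hs
    obtain ⟨i, hi⟩ : ∃ i, i ∉ s := by
      by_contra! h
      exact hs (Finset.eq_univ_iff_forall.2 h)
    exact h0 _ i (-(c i)) (by simp [hi])
  · simp

/-- Euclidean space is the metric cone over the round sphere: `dx² = dr² + r² f^*g` and
`dx¹ ∧ … ∧ dx^{d+1} = r^d dr ∧ f^*μ` for the radial projection `f`, whose derivative enters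
through the formula that characterizes it. -/
theorem exists_isConeData_radial (x : Punctured (d + 1)) (y : Sph d)
    (D : TangentSpace (𝓡 (d + 1)) x →L[ℝ] TangentSpace (𝓡 d) y)
    (hD : ∀ v, mvfderiv (𝓡 d) (Subtype.val : Sph d → EuclideanSpace ℝ (Fin (d + 1))) y (D v) =
      ‖x.1‖⁻¹ • (mvfderiv (𝓡 (d + 1))
          (Subtype.val : Punctured (d + 1) → EuclideanSpace ℝ (Fin (d + 1))) x v -
        ⟪y.1, mvfderiv (𝓡 (d + 1))
          (Subtype.val : Punctured (d + 1) → EuclideanSpace ℝ (Fin (d + 1))) x v⟫ • y.1)) :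
    ∃ e : Fin d → TangentSpace (𝓡 d) y, IsConeData (sphBilin y) (sphVol d y) (puncBilin x)
      (puncVol (d + 1) x) D (radialCovector x y) ‖x.1‖ e := by
  obtain ⟨e, he, hspan⟩ := exists_orthonormal_sph y
  have hr : ‖x.1‖ ≠ 0 := (punctured_norm_pos x).ne'
  have hy : ⟪y.1, y.1⟫ = (1 : ℝ) := by
    rw [real_inner_self_eq_norm_sq, norm_eq_of_mem_sphere, one_pow]
  set J := mvfderiv (𝓡 d) (Subtype.val : Sph d → EuclideanSpace ℝ (Fin (d + 1))) y with hJ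
  set K := mvfderiv (𝓡 (d + 1))
    (Subtype.val : Punctured (d + 1) → EuclideanSpace ℝ (Fin (d + 1))) x with hK
  have hKv : ∀ v : EuclideanSpace ℝ (Fin (d + 1)), K v = v := mvfderiv_coe_punctured x
  have hℓ : ∀ v, radialCovector x y v = ⟪y.1, K v⟫ := fun v => rfl
  refine ⟨e, hr, he, hspan, ?_, ?_, ?_, ?_⟩
  · intro u v
    change ⟪K u, K v⟫ = _ + ‖x.1‖ ^ 2 * ⟪J (D u), J (D v)⟫
    rw [hD, hD, hℓ, hℓ, inner_smul_left, inner_smul_right]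
    simp only [inner_sub_left, inner_sub_right, inner_smul_left, inner_smul_right, hy,
      real_inner_comm y.1 (K u), conj_trivial]
    field_simp
    ring
  · have h := eq_wedgeCovector_curryLeft finrank_euclideanSpace_fin (euclideanVol (d + 1))
      (innerSL ℝ y.1) y.1 hy
    have h2 : puncVol (d + 1) x = wedgeCovector (radialCovector x y)
        (((euclideanVol (d + 1)).curryLeft y.1).compContinuousLinearMap K) := by
      rw [puncVol, h, wedgeCovector_compContinuousLinearMap, ← h]
      rfl
    have h3 : ((euclideanVol (d + 1)).curryLeft y.1).compContinuousLinearMap K =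
        ‖x.1‖ ^ d • (sphVol d y).compContinuousLinearMap D := by
      ext v
      change (euclideanVol (d + 1)).curryLeft y.1 (fun i => K (v i)) =
        ‖x.1‖ ^ d • (euclideanVol (d + 1)).curryLeft y.1 (fun i => J (D (v i)))
      simp only [hD]
      rw [((euclideanVol (d + 1)).curryLeft y.1).map_smul_univ (fun _ => ‖x.1‖⁻¹)
        (fun i => K (v i) - ⟪y.1, K (v i)⟫ • y.1), curryLeft_sub_smul]
      simp [hr]
    rw [h2, h3]
    ext v
    simp only [wedgeCovector_apply, ContinuousAlternatingMap.smul_apply, Finset.smul_sum]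
    refine Finset.sum_congr rfl fun i _ => ?_
    simp only [smul_eq_mul]
    ring
  · intro w h1 h2
    have h3 := hD w
    rw [h2, map_zero, ← hℓ, h1, zero_smul, sub_zero] at h3
    have h4 : K w = 0 := (smul_eq_zero.1 h3.symm).resolve_left (inv_ne_zero hr)
    exact (hKv w).symm.trans h4
  · intro a u
    let w : EuclideanSpace ℝ (Fin (d + 1)) := a • y.1 + ‖x.1‖ • J u
    have hJu : ⟪y.1, J u⟫ = 0 := inner_mvfderiv_coe_sph y u
    have hw : ⟪y.1, w⟫ = a := by
      simp only [w, inner_add_right, inner_smul_right, hy, hJu]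
      ring
    refine ⟨w, ?_, ?_⟩
    · exact (hℓ w).trans ((congrArg (fun z => ⟪y.1, z⟫) (hKv w)).trans hw)
    · refine mvfderiv_coe_sph_injective y ?_
      refine (hD w).trans ?_
      have h5 : K w = w := hKv w
      rw [h5, hw]
      simp only [w, add_sub_cancel_left, smul_smul, inv_mul_cancel₀ hr, one_smul]
      rfl

end Sphere

/-! ### The operator `∗D∗` on the pullback bundle -/

namespace PrincipalBundle

variable
  {EG HG : Type*} [NormedAddCommGroup EG] [NormedSpace ℝ EG] [TopologicalSpace HG]
  {IG : ModelWithCorners ℝ EG HG} {G : Type*} [TopologicalSpace G] [ChartedSpace HG G] [Group G]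
  {EP HP : Type*} [NormedAddCommGroup EP] [NormedSpace ℝ EP] [TopologicalSpace HP]
  {IP : ModelWithCorners ℝ EP HP} {P : Type*} [TopologicalSpace P] [ChartedSpace HP P]

theorem star_neg {EM HM : Type*} [NormedAddCommGroup EM] [NormedSpace ℝ EM] [TopologicalSpace HM]
    {IM : ModelWithCorners ℝ EM HM} {M : Type*} [TopologicalSpace M] [ChartedSpace HM M]
    (B : PrincipalBundle IG G IP P IM M) {V : Type*} [NormedAddCommGroup V] [NormedSpace ℝ V]
    {k l m : ℕ} (g : ∀ x : M, TangentSpace IM x → TangentSpace IM x → ℝ) (μ : DForm IM M m ℝ)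
    (A : DForm IP P 1 (LieAlg IG G)) (h : k + l = m) (φ : DForm IP P k V) (p : P) :
    B.star g μ A h (fun p => -φ p) p = -B.star g μ A h φ p := by
  have h1 := hodgeStar_smul (g (B.proj p)) (μ (B.proj p)) h (-1)
    ((φ p).compContinuousLinearMap (B.lift A p))
  rw [neg_one_smul, neg_one_smul] at h1
  ext v
  exact congrArg (fun η => η fun i => mfderiv IP IM B.proj p (v i)) h1

variable {d : ℕ} (B : PrincipalBundle IG G IP P (𝓡 d) (Sph d))
  {V : Type*} [NormedAddCommGroup V] [NormedSpace ℝ V] {k l : ℕ}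

theorem exists_isConeData (q : B.Pullback) :
    ∃ e, IsConeData (sphBilin (B.proj q.toP)) (sphVol d (B.proj q.toP))
      (puncBilin (B.pullbackBundle.proj q)) (puncVol (d + 1) (B.pullbackBundle.proj q))
      (B.radialDeriv q) (radialCovector (B.pullbackBundle.proj q) (B.proj q.toP))
      ‖q.base.1‖ e :=
  exists_isConeData_radial q.base (B.proj q.toP) (B.radialDeriv q)
    (mvfderiv_coe_mfderiv_radial q.base (B.proj q.toP) q.proj_eq (B.radialDeriv q) rfl)

/-- `dt = dr / r` on the pullback bundle. -/
theorem radialCovector_mfderiv_proj (q : B.Pullback) (X : TangentSpace (IP.prod 𝓘(ℝ, ℝ)) q) :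
    radialCovector (B.pullbackBundle.proj q) (B.proj q.toP)
        (mfderiv (IP.prod 𝓘(ℝ, ℝ)) (𝓡 (d + 1)) B.pullbackBundle.proj q X) =
      ‖q.base.1‖ * mvfderiv (IP.prod 𝓘(ℝ, ℝ)) B.logRadius q X := by
  have hx : q.base.1 ≠ 0 := q.base.2
  have hr : ‖q.base.1‖ ≠ 0 := norm_ne_zero_iff.2 hx
  have hN : HasFDerivAt (fun z : EuclideanSpace ℝ (Fin (d + 1)) => Real.log ‖z‖) _ q.base.1 :=
    (hasFDerivAt_norm_euclidean hx).log hr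
  have hbase := B.pullbackBundle.mdifferentiableAt_proj q
  have h1 := mfderiv_comp_apply q (mdifferentiableAt_coe_punctured (B.pullbackBundle.proj q)) hbase X
  have h2 := mfderiv_comp_apply q (f := fun q : B.Pullback => q.base.1)
    (hN.differentiableAt.mdifferentiableAt)
    ((mdifferentiableAt_coe_punctured (B.pullbackBundle.proj q)).comp q hbase) X
  rw [mfderiv_eq_fderiv, hN.fderiv] at h2
  have h3 : mvfderiv (IP.prod 𝓘(ℝ, ℝ)) B.logRadius q X = ‖q.base.1‖⁻¹ * (‖q.base.1‖⁻¹ *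
      ⟪q.base.1, mvfderiv (𝓡 (d + 1))
        (Subtype.val : Punctured (d + 1) → EuclideanSpace ℝ (Fin (d + 1))) (B.pullbackBundle.proj q)
        (mfderiv (IP.prod 𝓘(ℝ, ℝ)) (𝓡 (d + 1)) B.pullbackBundle.proj q X)⟫) :=
    h2.trans (congrArg (fun w => ‖q.base.1‖⁻¹ * (‖q.base.1‖⁻¹ * ⟪q.base.1, w⟫)) h1)
  have hy : (B.proj q.toP).1 = ‖q.base.1‖⁻¹ • q.base.1 := congrArg Subtype.val q.proj_eq
  rw [h3, ← mul_assoc, mul_inv_cancel₀ hr, one_mul]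
  change ⟪(B.proj q.toP).1, _⟫ = _
  rw [hy, inner_smul_left]
  rfl

/-- Pulling back forms under the bundle homomorphism, a submersion onto `P`, is injective. -/
theorem eq_zero_of_pullbackForm_eq_zero (φ : DForm IP P k V)
    (h : ∀ q, B.pullbackForm φ q = 0) (p : P) : φ p = 0 := by
  let q : B.Pullback := B.pullbackHomeo.symm (p, 0)
  have hs : MDifferentiableAt IP (IP.prod 𝓘(ℝ, ℝ)) (fun p => B.pullbackHomeo.symm (p, 0)) p := by
    have : ContMDiff IP (IP.prod 𝓘(ℝ, ℝ)) ∞ (fun p => B.pullbackHomeo.symm (p, 0)) :=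
      B.contMDiff_pullbackHomeo_symm.comp (contMDiff_id.prodMk contMDiff_const)
    exact this.mdifferentiableAt (by simp)
  have hsurj : ∀ v : TangentSpace IP p,
      mfderiv (IP.prod 𝓘(ℝ, ℝ)) IP (Pullback.toP : B.Pullback → P) q
        (mfderiv IP (IP.prod 𝓘(ℝ, ℝ)) (fun p => B.pullbackHomeo.symm (p, 0)) p v) = v := by
    intro v
    have h1 := mfderiv_comp_apply p (B.mdifferentiableAt_toP q) hs v
    have hid : (Pullback.toP : B.Pullback → P) ∘ (fun p => B.pullbackHomeo.symm (p, 0)) = id := rfl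
    rw [hid, mfderiv_id] at h1
    exact h1.symm
  ext v
  have h2 := congrArg (fun η => η fun i =>
    mfderiv IP (IP.prod 𝓘(ℝ, ℝ)) (fun p => B.pullbackHomeo.symm (p, 0)) p (v i)) (h q)
  exact (congrArg (φ p) (funext fun i => (hsurj (v i)).symm)).trans h2

variable [LieGroup IG ∞ G]

/-- The Hodge star of the pullback of a form `φ` of degree `2`: `∗ F^* φ = r^{d-3} dt ∧ F^*(∗φ)`
with `t = log r`. -/
theorem star_pullbackForm {A : DForm IP P 1 (LieAlg IG G)} (hA : B.IsConnection A)
    (hA' : B.pullbackBundle.IsConnection (B.pullbackForm A)) (h : 1 + 1 + l = d)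
    (h' : 1 + 1 + (l + 1) = d + 1) (φ : DForm IP P (1 + 1) V) :
    B.pullbackBundle.star (puncMetric (d + 1)) (puncVol (d + 1)) (B.pullbackForm A) h'
        (B.pullbackForm φ) =
      B.expWedge ((d : ℝ) - 3) (B.star (sphMetric d) (sphVol d) A h φ) := by
  funext q
  obtain ⟨e, H⟩ := B.exists_isConeData q
  have h1 : (B.pullbackForm φ q).compContinuousLinearMap
      (B.pullbackBundle.lift (B.pullbackForm A) q) =
      ((φ q.toP).compContinuousLinearMap (B.lift A q.toP)).compContinuousLinearMap
        (B.radialDeriv q) := by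
    ext v
    exact congrArg (φ q.toP) (funext fun i => B.mfderiv_toP_lift hA hA' q (v i))
  have h2 := H.hodgeStar_pullback h h' ((φ q.toP).compContinuousLinearMap (B.lift A q.toP))
  have hr := punctured_norm_pos q.base
  -- The exponent is `d - 2 * 2` from the Hodge star on `2`-forms, plus `1` from `dr = r dt`.
  have hexp : Real.exp (((d : ℝ) - 3) * B.logRadius q) =
      (-1) ^ (1 + 1) * ‖q.base.1‖ ^ d * (‖q.base.1‖⁻¹ ^ (1 + 1)) ^ 2 * ‖q.base.1‖ := by
    have hL : ‖q.base.1‖ = Real.exp (B.logRadius q) := (Real.exp_log hr).symm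
    rw [hL, ← Real.exp_neg, ← Real.exp_nat_mul, ← Real.exp_nat_mul, ← Real.exp_nat_mul]
    norm_num
    rw [← Real.exp_add, ← Real.exp_add]
    congr 1
    ring
  ext v
  change hodgeStar (fun u v => puncBilin (B.pullbackBundle.proj q) u v) (puncVol (d + 1) (B.pullbackBundle.proj q)) h'
    ((B.pullbackForm φ q).compContinuousLinearMap (B.pullbackBundle.lift (B.pullbackForm A) q))
      (fun i => mfderiv (IP.prod 𝓘(ℝ, ℝ)) (𝓡 (d + 1)) B.pullbackBundle.proj q (v i)) = _
  rw [h1, h2, expWedge, ContinuousAlternatingMap.smul_apply, ContinuousAlternatingMap.smul_apply,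
    hexp, mul_smul _ ‖q.base.1‖, wedgeCovector_apply, wedgeCovector_apply]
  refine congrArg _ ?_
  rw [Finset.smul_sum]
  refine Finset.sum_congr rfl fun i _ => ?_
  rw [radialCovector_mfderiv_proj, mul_smul, smul_comm ‖q.base.1‖ ((-1 : ℝ) ^ (i : ℕ))]
  refine congrArg (fun x : V => (-1 : ℝ) ^ (i : ℕ) • ‖q.base.1‖ •
    mvfderiv (IP.prod 𝓘(ℝ, ℝ)) B.logRadius q (v i) • x) ?_
  exact congrArg (hodgeStar (sphMetric d (B.proj q.toP)) (sphVol d (B.proj q.toP)) h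
    ((φ q.toP).compContinuousLinearMap (B.lift A q.toP)))
    (funext fun j => (B.mfderiv_proj_toP q (i.removeNth v j)).symm)

/-- The Hodge star of the wedge product of `dt` with the pullback of a form `ψ` of degree `k`:
`∗(dt ∧ F^* ψ) = r^{d-1-2k} F^*(∗ψ)`. -/
theorem star_expWedge {A : DForm IP P 1 (LieAlg IG G)} (hA : B.IsConnection A)
    (hA' : B.pullbackBundle.IsConnection (B.pullbackForm A)) (h : k + l = d)
    (h' : k + 1 + l = d + 1) (c : ℝ) (ψ : DForm IP P k V) (q : B.Pullback) :
    B.pullbackBundle.star (puncMetric (d + 1)) (puncVol (d + 1)) (B.pullbackForm A) h'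
        (B.expWedge c ψ) q =
      (Real.exp (c * B.logRadius q) * ‖q.base.1‖⁻¹ *
        (‖q.base.1‖ ^ d * (‖q.base.1‖⁻¹ ^ k) ^ 2)) •
          B.pullbackForm (B.star (sphMetric d) (sphVol d) A h ψ) q := by
  obtain ⟨e, H⟩ := B.exists_isConeData q
  have hr := (punctured_norm_pos q.base).ne'
  have hdt : ∀ v : TangentSpace (𝓡 (d + 1)) (B.pullbackBundle.proj q), mvfderiv (IP.prod 𝓘(ℝ, ℝ)) B.logRadius q
      (B.pullbackBundle.lift (B.pullbackForm A) q v) =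
        ‖q.base.1‖⁻¹ * radialCovector (B.pullbackBundle.proj q) (B.proj q.toP) v := by
    intro v
    have := B.radialCovector_mfderiv_proj q (B.pullbackBundle.lift (B.pullbackForm A) q v)
    have h0 : mfderiv (IP.prod 𝓘(ℝ, ℝ)) (𝓡 (d + 1)) B.pullbackBundle.proj q
      (B.pullbackBundle.lift (B.pullbackForm A) q v) = v := hA'.mfderiv_proj_lift q v
    rw [h0] at this
    rw [this, ← mul_assoc, inv_mul_cancel₀ hr, one_mul]
  have h1 : (B.expWedge c ψ q).compContinuousLinearMap
      (B.pullbackBundle.lift (B.pullbackForm A) q) =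
      (Real.exp (c * B.logRadius q) * ‖q.base.1‖⁻¹) •
        wedgeCovector (radialCovector (B.pullbackBundle.proj q) (B.proj q.toP))
          (((ψ q.toP).compContinuousLinearMap (B.lift A q.toP)).compContinuousLinearMap
            (B.radialDeriv q)) := by
    ext v
    change (B.expWedge c ψ q) (fun i => B.pullbackBundle.lift (B.pullbackForm A) q (v i)) = _
    rw [expWedge, ContinuousAlternatingMap.smul_apply, ContinuousAlternatingMap.smul_apply,
      mul_smul, wedgeCovector_apply, wedgeCovector_apply]
    refine congrArg _ ?_
    rw [Finset.smul_sum]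
    refine Finset.sum_congr rfl fun i _ => ?_
    rw [smul_comm ‖q.base.1‖⁻¹, smul_smul ‖q.base.1‖⁻¹]
    refine congrArg _ ?_
    refine (congrArg (fun x => x • _) (hdt (v i))).trans (congrArg _ ?_)
    exact congrArg (ψ q.toP) (funext fun j => B.mfderiv_toP_lift hA hA' q (i.removeNth v j))
  have h2 := H.hodgeStar_wedgeCovector h h' ((ψ q.toP).compContinuousLinearMap (B.lift A q.toP))
  ext v
  change hodgeStar (fun u v => puncBilin (B.pullbackBundle.proj q) u v) (puncVol (d + 1) (B.pullbackBundle.proj q)) h'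
    ((B.expWedge c ψ q).compContinuousLinearMap (B.pullbackBundle.lift (B.pullbackForm A) q))
      (fun i => mfderiv (IP.prod 𝓘(ℝ, ℝ)) (𝓡 (d + 1)) B.pullbackBundle.proj q (v i)) = _
  rw [h1, hodgeStar_smul, h2, smul_smul, ContinuousAlternatingMap.smul_apply,
    ContinuousAlternatingMap.smul_apply]
  refine congrArg _ ?_
  exact congrArg (hodgeStar (sphMetric d (B.proj q.toP)) (sphVol d (B.proj q.toP)) h
    ((ψ q.toP).compContinuousLinearMap (B.lift A q.toP)))
    (funext fun j => (B.mfderiv_proj_toP q (v j)).symm)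

/-- `∗D∗ F^* φ = -r^{-2} F^*(∗D∗ φ)` for forms `φ` of degree `2`, in every dimension `d ≥ 2`. -/
theorem starDStar_pullbackForm [IsManifold IP ∞ P] [IP.Boundaryless]
    {A : DForm IP P 1 (LieAlg IG G)} (hA : B.IsConnection A) (hd : 1 + 1 ≤ d)
    (hd' : 1 + 1 ≤ d + 1) (φ : DForm IP P (1 + 1) V) (q : B.Pullback) :
    B.pullbackBundle.starDStar (puncMetric (d + 1)) (puncVol (d + 1)) (B.pullbackForm A) hd'
        (B.pullbackForm φ) q =
      (-(1 / ‖q.base.1‖ ^ 2)) •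
        B.pullbackForm (B.starDStar (sphMetric d) (sphVol d) A hd φ) q := by
  have hA' := B.isConnection_pullbackForm hA
  obtain ⟨l, hl⟩ : ∃ l, 1 + 1 + l = d := ⟨d - 2, by omega⟩
  rw [B.starDStar_eq _ _ A hd hl (by omega),
    B.pullbackBundle.starDStar_eq _ _ _ hd' (l := l + 1) (by omega) (by omega),
    B.star_pullbackForm hA hA' hl (by omega), covD_expWedge, star_neg,
    B.star_expWedge hA hA' (by omega) (by omega), ← neg_smul]
  congr 2
  have hr := punctured_norm_pos q.base
  have hL : ‖q.base.1‖ = Real.exp (B.logRadius q) := (Real.exp_log hr).symm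
  rw [hL, one_div, ← Real.exp_neg, ← Real.exp_nat_mul, ← Real.exp_nat_mul, ← Real.exp_nat_mul,
    ← Real.exp_nat_mul, ← Real.exp_neg, ← Real.exp_add, ← Real.exp_add, ← Real.exp_add]
  congr 1
  have hl' : (d : ℝ) = 1 + 1 + l := by rw [← hl]; push_cast; ring
  rw [hl']
  push_cast
  ring

end PrincipalBundle

theorem mainTheorem1
    {EG HG : Type*} [NormedAddCommGroup EG] [NormedSpace ℝ EG] [FiniteDimensional ℝ EG]
    [TopologicalSpace HG] {IG : ModelWithCorners ℝ EG HG} [IG.Boundaryless]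
    {G : Type*} [TopologicalSpace G] [ChartedSpace HG G] [Group G] [LieGroup IG ∞ G]
    {EP HP : Type*} [NormedAddCommGroup EP] [NormedSpace ℝ EP] [FiniteDimensional ℝ EP]
    [TopologicalSpace HP] {IP : ModelWithCorners ℝ EP HP} [IP.Boundaryless]
    {P : Type*} [TopologicalSpace P] [ChartedSpace HP P] [IsManifold IP ∞ P]
    (n : ℕ) (hn : 1 ≤ n)
    (B : PrincipalBundle IG G IP P (𝓡 (2 * n)) (Sph (2 * n)))
    (A : DForm IP P 1 (LieAlg IG G)) (hA : B.IsConnection A) :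
    -- the pullback `F^*A` of the connection is a connection
    B.pullbackBundle.IsConnection (B.pullbackForm A) ∧
    -- `∗D∗ Ω^{F^*A} = -(1/r²) F^*(∗D∗ Ω^A)`
    (∀ q : B.Pullback,
      B.pullbackBundle.starDStar (puncMetric (2 * n + 1)) (puncVol (2 * n + 1)) (B.pullbackForm A)
          (two_le_dim_punc hn) (B.pullbackBundle.curvature (B.pullbackForm A)) q =
        (-(1 / ‖q.base.1‖ ^ 2)) • B.pullbackForm
          (B.starDStar (sphMetric (2 * n)) (sphVol (2 * n)) A (two_le_dim_sph hn)
            (B.curvature A)) q) ∧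
    -- `δ Ω^{F^*A} = (1/r²) F^*(δ Ω^A)` for `δ = -(-1)^{m(k+1)} ∗D∗` on `k`-forms, `m = dim`
    (∀ q : B.Pullback,
      B.pullbackBundle.codiff (puncMetric (2 * n + 1)) (puncVol (2 * n + 1)) (B.pullbackForm A)
          (two_le_dim_punc hn) (B.pullbackBundle.curvature (B.pullbackForm A)) q =
        (1 / ‖q.base.1‖ ^ 2) • B.pullbackForm
          (B.codiff (sphMetric (2 * n)) (sphVol (2 * n)) A (two_le_dim_sph hn)
            (B.curvature A)) q) ∧
    -- `A` is Yang–Mills if and only if `F^*A` is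
    (B.IsYangMills (sphMetric (2 * n)) (sphVol (2 * n)) (two_le_dim_sph hn) A ↔
      B.pullbackBundle.IsYangMills (puncMetric (2 * n + 1)) (puncVol (2 * n + 1))
        (two_le_dim_punc hn) (B.pullbackForm A)) := by

  have hA' := B.isConnection_pullbackForm hA
  have hstar : ∀ q : B.Pullback,
      B.pullbackBundle.starDStar (puncMetric (2 * n + 1)) (puncVol (2 * n + 1)) (B.pullbackForm A)
          (two_le_dim_punc hn) (B.pullbackBundle.curvature (B.pullbackForm A)) q =
        (-(1 / ‖q.base.1‖ ^ 2)) • B.pullbackForm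
          (B.starDStar (sphMetric (2 * n)) (sphVol (2 * n)) A (two_le_dim_sph hn)
            (B.curvature A)) q := by
    intro q
    rw [B.curvature_pullbackForm]
    exact B.starDStar_pullbackForm hA (two_le_dim_sph hn) (two_le_dim_punc hn) (B.curvature A) q
  have hcodiff : ∀ q : B.Pullback,
      B.pullbackBundle.codiff (puncMetric (2 * n + 1)) (puncVol (2 * n + 1)) (B.pullbackForm A)
          (two_le_dim_punc hn) (B.pullbackBundle.curvature (B.pullbackForm A)) q =
        (1 / ‖q.base.1‖ ^ 2) • B.pullbackForm
          (B.codiff (sphMetric (2 * n)) (sphVol (2 * n)) A (two_le_dim_sph hn)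
            (B.curvature A)) q := by
    intro q
    -- the sign `-(-1)^{3m}` is `1` for `m = 2n + 1` and `-1` for `m = 2n`
    have hodd : Odd ((2 * n + 1) * (1 + 1 + 1)) := ⟨3 * n + 1, by ring⟩
    have heven : Even (2 * n * (1 + 1 + 1)) := ⟨n * 3, by ring⟩
    have hpull : B.pullbackForm (B.codiff (sphMetric (2 * n)) (sphVol (2 * n)) A
        (two_le_dim_sph hn) (B.curvature A)) q = (-(-1 : ℝ) ^ (2 * n * (1 + 1 + 1))) •
          B.pullbackForm (B.starDStar (sphMetric (2 * n)) (sphVol (2 * n)) A (two_le_dim_sph hn)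
            (B.curvature A)) q := rfl
    rw [hpull, PrincipalBundle.codiff, hstar, hodd.neg_one_pow, heven.neg_one_pow, neg_neg,
      one_smul, smul_smul, mul_neg_one]
  refine ⟨hA', hstar, hcodiff, fun h => ⟨hA', funext fun q => ?_⟩,
    fun h => ⟨hA, funext fun p => ?_⟩⟩
  · rw [hcodiff, h.2]
    ext v
    exact smul_zero _
  · refine B.eq_zero_of_pullbackForm_eq_zero _ (fun q => ?_) p
    have h1 := hcodiff q
    rw [h.2] at h1
    have hr := punctured_norm_pos q.base
    exact (smul_eq_zero.1 h1.symm).resolve_left (by positivity)
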